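/- Let $a<b$ be real numbers, let $1\le p\le\infty$, and let $m,r,l\ge 1$ and $n\ge 0$ be integers. For $k\ge1$ let $W_p^{k}=W_p^{k}([a,b];\mathbb{C})$ be the complex Sobolev space of all $y\in C^{k-1}[a,b]$ such that $y^{(k-1)}$ is absolutely continuous on $[a,b]$ and $y^{(k)}\in L_p[a,b]$; put $W_p^0=L_p[a,b]$. These spaces carry the norm $\|y\|_{k,p}=\sum_{i=0}^{k}\|y^{(i)}\|_p$. Spaces of vector- and matrix-valued functions with entries in $W_p^k$ are denoted by $(W_p^k)^m$ and $(W_p^k)^{m\times m}$. Let $A_0,\dots,A_{r-1}\in (W_p^{n})^{m\times m}$, let $B\colon (W_p^{n+r})^m\to\mathbb{C}^l$ be a continuous linear operator, and put $$Ly=y^{(r)}+\sum_{j=1}^{r}A_{r-j}\,y^{(r-j)},\qquad (L,B)\colon (W_p^{n+r})^m\to (W_p^{n})^m\times\mathbb{C}^l,\quad y\mapsto (Ly,By).$$ Then there are unique matrix-valued functions $Y_0,\dots,Y_{r-1}\in (W_p^{n+r})^{m\times m}$ that solve the Cauchy problems $$Y_k^{(r)}+\sum_{j=1}^{r}A_{r-j}\,Y_k^{(r-j)}=0\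 \text{ on }(a,b),\qquad Y_k^{(q)}(a)=\delta_{k,q}I_m\quad (0\le q\le r-1).$$ Let $[BY_k]\in\mathbb{C}^{l\times m}$ be the matrix whose $c$-th column is $B$ applied to the $c$-th column of $Y_k$, and let $$M(L,B)=\bigl([BY_0],\dots,[BY_{r-1}]\bigr)\in\mathbb{C}^{l\times mr}$$ be the characteristic matrix. The operator $(L,B)$ is invertible (that is, a bounded linear bijection with a bounded inverse) if and only if $l=mr$ and the square matrix $M(L,B)$ is nondegenerate, i.e. $\det M(L,B)\neq0$. -/

import Mathlib

open MeasureTheory Set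
open scoped ENNReal

noncomputable section

/-- `y ∈ W_p^k([a,b]; ℂ)` for a concrete function `y`: for `k = 0` this means `y ∈ L_p[a,b]`; for
`k + 1` it means `y ∈ C^k[a,b]`, `y^(k) ∈ AC[a,b]` and `y^(k+1) ∈ L_p[a,b]`. Only the values of `y`
on `[a,b]` matter; derivatives at `a` and `b` are one-sided. -/
def MemSobolev (a b : ℝ) (p : ℝ≥0∞) : ℕ → (ℝ → ℂ) → Prop
  | 0, y => MemLp y p (volume.restrict (Icc a b))
  | k + 1, y => ContDiffOn ℝ k y (Icc a b) ∧
      AbsolutelyContinuousOnInterval (iteratedDerivWithin k y (Icc a b)) a b ∧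
      MemLp (iteratedDerivWithin (k + 1) y (Icc a b)) p (volume.restrict (Icc a b))

namespace MemSobolev

variable {a b : ℝ} {p : ℝ≥0∞}

theorem ac_congr {f g : ℝ → ℂ} (hab : a < b) (h : EqOn f g (Icc a b))
    (hf : AbsolutelyContinuousOnInterval f a b) : AbsolutelyContinuousOnInterval g a b := by
  rw [absolutelyContinuousOnInterval_iff] at hf ⊢
  intro ε hε
  obtain ⟨δ, hδ, H⟩ := hf ε hε
  refine ⟨δ, hδ, fun E hE hl => ?_⟩
  have := H E hE hl
  rw [← uIcc_of_le hab.le] at h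
  convert this using 2 with i hi
  rw [h (hE.1 i hi).1, h (hE.1 i hi).2]

theorem ae_of_eqOn {f g : ℝ → ℂ} (h : EqOn f g (Icc a b)) :
    f =ᵐ[volume.restrict (Icc a b)] g :=
  (ae_restrict_iff' measurableSet_Icc).2 (Filter.Eventually.of_forall h)

theorem memLp_of_continuousOn {f : ℝ → ℂ} (h : ContinuousOn f (Icc a b)) :
    MemLp f p (volume.restrict (Icc a b)) := by
  obtain ⟨C, hC⟩ := isCompact_Icc.exists_bound_of_continuousOn h
  exact MemLp.of_bound (h.aestronglyMeasurable measurableSet_Icc) C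
    ((ae_restrict_iff' measurableSet_Icc).2 (Filter.Eventually.of_forall hC))

theorem ac_continuousOn {f : ℝ → ℂ} (hab : a < b) (hf : AbsolutelyContinuousOnInterval f a b) :
    ContinuousOn f (Icc a b) := by
  rw [← uIcc_of_le hab.le]; exact hf.continuousOn

theorem ac_ae_differentiable {f : ℝ → ℂ} (hab : a < b)
    (hf : AbsolutelyContinuousOnInterval f a b) :
    ∀ᵐ x ∂(volume.restrict (Icc a b)), x ∈ Icc a b ∧ DifferentiableWithinAt ℝ f (Icc a b) x := by
  rw [ae_restrict_iff' measurableSet_Icc]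
  have h := hf.boundedVariationOn
  rw [uIcc_of_le hab.le] at h
  filter_upwards [h.locallyBoundedVariationOn.ae_differentiableWithinAt_of_mem] with x hx hx'
  exact ⟨hx', hx hx'⟩

theorem congr {k : ℕ} {f g : ℝ → ℂ} (hab : a < b) (h : EqOn f g (Icc a b))
    (hf : MemSobolev a b p k f) : MemSobolev a b p k g := by
  cases k with
  | zero => exact (memLp_congr_ae (ae_of_eqOn h)).1 hf
  | succ k =>
    exact ⟨hf.1.congr fun x hx => (h hx).symm, ac_congr hab (iteratedDerivWithin_congr h) hf.2.1,
      (memLp_congr_ae (ae_of_eqOn (iteratedDerivWithin_congr h))).1 hf.2.2⟩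

theorem continuousOn {k : ℕ} {f : ℝ → ℂ} (hf : MemSobolev a b p (k + 1) f) :
    ContinuousOn f (Icc a b) := hf.1.continuousOn

theorem iteratedDerivWithin_add_ae {k : ℕ} {f g : ℝ → ℂ} (hab : a < b)
    (hf : MemSobolev a b p k f) (hg : MemSobolev a b p k g) {i : ℕ} (hi : i ≤ k) :
    iteratedDerivWithin i (f + g) (Icc a b) =ᵐ[volume.restrict (Icc a b)]
      iteratedDerivWithin i f (Icc a b) + iteratedDerivWithin i g (Icc a b) := by
  have hu := uniqueDiffOn_Icc hab
  cases k with
  | zero =>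
    obtain rfl : i = 0 := by omega
    simp
  | succ k =>
    have key : ∀ j ≤ k, EqOn (iteratedDerivWithin j (f + g) (Icc a b))
        (iteratedDerivWithin j f (Icc a b) + iteratedDerivWithin j g (Icc a b)) (Icc a b) := by
      intro j hj x hx
      have hjk : ((j : ℕ) : WithTop ℕ∞) ≤ k := by exact_mod_cast hj
      exact iteratedDerivWithin_add hx hu ((hf.1 x hx).of_le hjk) ((hg.1 x hx).of_le hjk)
    rcases Nat.lt_or_ge k i with h | h
    · obtain rfl : i = k + 1 := by omega
      filter_upwards [ac_ae_differentiable hab hf.2.1, ac_ae_differentiable hab hg.2.1]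
        with x hx hy
      simp only [iteratedDerivWithin_succ, Pi.add_apply]
      rw [derivWithin_congr (key k le_rfl) (key k le_rfl hx.1), derivWithin_add hx.2 hy.2]
    · exact ae_of_eqOn (key i h)

theorem add {k : ℕ} {f g : ℝ → ℂ} (hab : a < b)
    (hf : MemSobolev a b p k f) (hg : MemSobolev a b p k g) : MemSobolev a b p k (f + g) := by
  have hu := uniqueDiffOn_Icc hab
  have hae := iteratedDerivWithin_add_ae hab hf hg (le_refl k)
  cases k with
  | zero => exact MemLp.add hf hg
  | succ k =>
    refine ⟨hf.1.add hg.1, ac_congr hab ?_ (hf.2.1.add hg.2.1),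
      (memLp_congr_ae hae).2 (hf.2.2.add hg.2.2)⟩
    intro x hx
    exact (iteratedDerivWithin_add hx hu (hf.1 x hx) (hg.1 x hx)).symm

theorem const_smul {k : ℕ} {f : ℝ → ℂ} (c : ℂ)
    (hf : MemSobolev a b p k f) : MemSobolev a b p k (c • f) := by
  have h : ∀ j, iteratedDerivWithin j (c • f) (Icc a b) =
      c • iteratedDerivWithin j f (Icc a b) := fun j => by
    funext x; exact iteratedDerivWithin_const_smul_field c f
  cases k with
  | zero => exact MemLp.const_smul hf c
  | succ k =>
    refine ⟨hf.1.const_smul c, ?_, ?_⟩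
    · rw [h]; exact hf.2.1.const_smul c
    · rw [h]; exact hf.2.2.const_smul c

theorem zero (k : ℕ) : MemSobolev a b p k 0 := by
  have h : ∀ j, iteratedDerivWithin j (0 : ℝ → ℂ) (Icc a b) = 0 := fun j => by
    funext x; simp
  cases k with
  | zero => exact MemLp.zero
  | succ k =>
    refine ⟨contDiffOn_const, ?_, ?_⟩
    · rw [h]
      exact (contDiffOn_const (c := (0 : ℂ))).absolutelyContinuousOnInterval
    · rw [h]; exact MemLp.zero

theorem sum {ι : Type*} {k : ℕ} (s : Finset ι) {f : ι → ℝ → ℂ} (hab : a < b)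
    (h : ∀ i ∈ s, MemSobolev a b p k (f i)) : MemSobolev a b p k (∑ i ∈ s, f i) := by
  classical
  induction s using Finset.induction_on with
  | empty => simpa using zero k
  | insert i s hi ih =>
    rw [Finset.sum_insert hi]
    exact add hab (h i (Finset.mem_insert_self i s))
      (ih fun j hj => h j (Finset.mem_insert_of_mem hj))

theorem succ_succ_iff {k : ℕ} {f : ℝ → ℂ} (hab : a < b) : MemSobolev a b p (k + 2) f ↔
    DifferentiableOn ℝ f (Icc a b) ∧ MemSobolev a b p (k + 1) (derivWithin f (Icc a b)) := by
  have hu := uniqueDiffOn_Icc hab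
  simp only [MemSobolev]
  rw [iteratedDerivWithin_succ' (n := k), iteratedDerivWithin_succ' (n := k + 1)]
  have : ((k + 1 : ℕ) : WithTop ℕ∞) = (k : WithTop ℕ∞) + 1 := by push_cast; rfl
  rw [this, contDiffOn_succ_iff_derivWithin hu]
  have hk : (k : WithTop ℕ∞) ≠ ⊤ := by simp
  simp [and_assoc]

theorem derivWithin {k : ℕ} {f : ℝ → ℂ} (hab : a < b) (hf : MemSobolev a b p (k + 1) f) :
    MemSobolev a b p k (derivWithin f (Icc a b)) := by
  cases k with
  | zero => simpa [MemSobolev, iteratedDerivWithin_succ] using hf.2.2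
  | succ k => exact ((succ_succ_iff hab).1 hf).2

theorem iteratedDerivWithin {k i : ℕ} {f : ℝ → ℂ} (hab : a < b) (hf : MemSobolev a b p (k + i) f) :
    MemSobolev a b p k (iteratedDerivWithin i f (Icc a b)) := by
  induction i generalizing k with
  | zero => simpa using hf
  | succ i ih =>
    rw [iteratedDerivWithin_succ]
    exact derivWithin hab (ih (by rwa [show k + 1 + i = k + (i + 1) by omega]))

theorem of_succ {k : ℕ} {f : ℝ → ℂ} (hab : a < b) (hf : MemSobolev a b p (k + 1) f) :
    MemSobolev a b p k f := by
  have hu := uniqueDiffOn_Icc hab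
  cases k with
  | zero => exact memLp_of_continuousOn hf.continuousOn
  | succ k =>
    have h1 : ContDiffOn ℝ 1 (_root_.iteratedDerivWithin k f (Icc a b)) (uIcc a b) := by
      rw [uIcc_of_le hab.le]
      exact ((contDiffOn_nat_succ_iff_contDiffOn_one_iteratedDerivWithin hu).1 hf.1).2
    refine ⟨hf.1.of_le (by exact_mod_cast Nat.le_succ k), h1.absolutelyContinuousOnInterval,
      memLp_of_continuousOn (ac_continuousOn hab hf.2.1)⟩

theorem of_le {k l : ℕ} {f : ℝ → ℂ} (hab : a < b) (h : k ≤ l) (hf : MemSobolev a b p l f) :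
    MemSobolev a b p k f := by
  induction l, h using Nat.le_induction with
  | base => exact hf
  | succ l _ ih => exact ih (of_succ hab hf)

theorem memLp_iteratedDerivWithin {k i : ℕ} {f : ℝ → ℂ} (hab : a < b)
    (hf : MemSobolev a b p k f) (hi : i ≤ k) :
    MemLp (_root_.iteratedDerivWithin i f (Icc a b)) p (volume.restrict (Icc a b)) :=
  iteratedDerivWithin (k := 0) hab (of_le hab (by omega) hf)

theorem memLp_mul {f g : ℝ → ℂ} (hf : MemLp f p (volume.restrict (Icc a b)))
    (hg : ContinuousOn g (Icc a b)) : MemLp (f * g) p (volume.restrict (Icc a b)) :=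
  MemLp.mul (p := p) (q := ∞) (r := p) (memLp_of_continuousOn hg) hf

theorem mul {k : ℕ} {f g : ℝ → ℂ} (hab : a < b) (hf : MemSobolev a b p k f)
    (hg : MemSobolev a b p (k + 1) g) : MemSobolev a b p k (f * g) := by
  induction k generalizing f g with
  | zero => exact memLp_mul hf hg.continuousOn
  | succ k ih =>
    have hf' := hf.derivWithin hab
    have hg' := hg.derivWithin hab
    have hg0 := of_succ hab hg
    have hsum := add hab (ih hf' hg0) (ih (of_succ hab hf) hg')
    cases k with
    | zero =>
      have hfac : AbsolutelyContinuousOnInterval f a b := by simpa using hf.2.1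
      have hgac : AbsolutelyContinuousOnInterval g a b := by simpa using hg0.2.1
      refine ⟨(hf.1.mul hg0.1), by simpa using hfac.smul hgac, (memLp_congr_ae ?_).1 hsum⟩
      filter_upwards [ac_ae_differentiable hab hfac, ac_ae_differentiable hab hgac] with x hx hy
      simp [iteratedDerivWithin_succ, derivWithin_mul hx.2 hy.2]
    | succ k =>
      have hfd := ((succ_succ_iff hab).1 hf).1
      have hgd := ((succ_succ_iff hab).1 hg0).1
      refine (succ_succ_iff hab).2 ⟨hfd.mul hgd, hsum.congr hab ?_⟩
      intro x hx
      simp [derivWithin_mul (hfd x hx) (hgd x hx)]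

theorem iteratedDerivWithin_ae_congr {k i : ℕ} {f g : ℝ → ℂ} (hab : a < b)
    (hf : MemSobolev a b p k f) (hg : MemSobolev a b p k g)
    (h : f =ᵐ[volume.restrict (Icc a b)] g) (hi : i ≤ k) :
    _root_.iteratedDerivWithin i f (Icc a b) =ᵐ[volume.restrict (Icc a b)]
      _root_.iteratedDerivWithin i g (Icc a b) := by
  cases k with
  | zero =>
    obtain rfl : i = 0 := by omega
    simpa using h
  | succ k =>
    exact ae_of_eqOn (iteratedDerivWithin_congr
      (Measure.eqOn_Icc_of_ae_eq _ hab.ne h hf.continuousOn hg.continuousOn))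

end MemSobolev

/-- The complex Sobolev space `W_p^k([a,b]; ℂ)` as a subspace. An element is stored as the tuple `(y, y', …, y^(k))` of the `L_p`-classes of a function and its derivatives; such a tuple is
determined by its first entry (see `Sobolev.ext_ae`). The space sits in the `ℓ¹`-product of `k + 1` copies of `L_p`, so
that its norm is `∑_{i ≤ k} ‖y^(i)‖_p`. -/
def sobolevSubmodule (a b : ℝ) [hab : Fact (a < b)] (p : ℝ≥0∞) [Fact (1 ≤ p)] (k : ℕ) :
    Submodule ℂ (PiLp 1 fun _ : Fin (k + 1) => Lp ℂ p (volume.restrict (Icc a b))) where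
  carrier := {u | ∃ y : ℝ → ℂ, MemSobolev a b p k y ∧ ∀ i : Fin (k + 1),
    u i =ᵐ[volume.restrict (Icc a b)] iteratedDerivWithin i y (Icc a b)}
  add_mem' := by
    rintro u v ⟨y, hy, hu⟩ ⟨z, hz, hv⟩
    refine ⟨y + z, hy.add hab.out hz, fun i => ?_⟩
    have hi : (i : ℕ) ≤ k := Nat.lt_succ_iff.1 i.2
    exact ((Lp.coeFn_add _ _).trans ((hu i).add (hv i))).trans
      (MemSobolev.iteratedDerivWithin_add_ae hab.out hy hz hi).symm
  zero_mem' := by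
    refine ⟨0, MemSobolev.zero k, fun i => ?_⟩
    have h : iteratedDerivWithin i (0 : ℝ → ℂ) (Icc a b) = 0 := by funext x; simp
    rw [h]
    exact Lp.coeFn_zero _ _ _
  smul_mem' := by
    rintro c u ⟨y, hy, hu⟩
    refine ⟨c • y, hy.const_smul c, fun i => ?_⟩
    have h : iteratedDerivWithin i (c • y) (Icc a b) = c • iteratedDerivWithin i y (Icc a b) := by
      funext x; exact iteratedDerivWithin_const_smul_field c y
    rw [h]
    exact (Lp.coeFn_smul _ _).trans ((hu i).const_smul c)

/-- The complex Sobolev space `W_p^k = W_p^k([a,b]; ℂ)`, normed by `∑_{i ≤ k} ‖y^(i)‖_p`, with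
`W_p^0 = L_p`. -/
abbrev Sobolev (a b : ℝ) [Fact (a < b)] (p : ℝ≥0∞) [Fact (1 ≤ p)] (k : ℕ) : Type :=
  sobolevSubmodule a b p k

namespace Sobolev

variable {a b : ℝ} [hab : Fact (a < b)] {p : ℝ≥0∞} [Fact (1 ≤ p)] {k : ℕ}

/-- The function on `[a,b]` that an element of `W_p^k` stands for: if `k ≥ 1`, its values on `[a,b]`
are uniquely determined (see `Sobolev.rep_eqOn`); if `k = 0`, its values are determined almost
everywhere. -/
def rep (u : Sobolev a b p k) : ℝ → ℂ := u.2.choose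

theorem memSobolev_rep (u : Sobolev a b p k) : MemSobolev a b p k u.rep := u.2.choose_spec.1

/-- The `i`-th derivative `u^(i)` on `[a,b]`. -/
def deriv (u : Sobolev a b p k) (i : ℕ) : ℝ → ℂ := iteratedDerivWithin i u.rep (Icc a b)

theorem coe_ae_eq_deriv (u : Sobolev a b p k) (i : Fin (k + 1)) :
    u.1 i =ᵐ[volume.restrict (Icc a b)] u.deriv i := u.2.choose_spec.2 i

theorem rep_eqOn (u : Sobolev a b p (k + 1)) {y : ℝ → ℂ} (hy : MemSobolev a b p (k + 1) y)
    (h : u.1 0 =ᵐ[volume.restrict (Icc a b)] y) : EqOn u.rep y (Icc a b) := by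
  have h0 : u.1 0 =ᵐ[volume.restrict (Icc a b)] u.rep := by
    simpa [deriv] using u.coe_ae_eq_deriv 0
  exact Measure.eqOn_Icc_of_ae_eq _ hab.out.ne (h0.symm.trans h)
    u.memSobolev_rep.continuousOn hy.continuousOn

theorem deriv_add_ae (u v : Sobolev a b p k) {i : ℕ} (hi : i ≤ k) :
    (u + v).deriv i =ᵐ[volume.restrict (Icc a b)] u.deriv i + v.deriv i := by
  have e := (u + v).coe_ae_eq_deriv ⟨i, Nat.lt_succ_iff.2 hi⟩
  exact e.symm.trans ((Lp.coeFn_add _ _).trans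
    ((u.coe_ae_eq_deriv ⟨i, Nat.lt_succ_iff.2 hi⟩).add (v.coe_ae_eq_deriv ⟨i, Nat.lt_succ_iff.2 hi⟩)))

theorem deriv_smul_ae (c : ℂ) (u : Sobolev a b p k) {i : ℕ} (hi : i ≤ k) :
    (c • u).deriv i =ᵐ[volume.restrict (Icc a b)] c • u.deriv i := by
  have e := (c • u).coe_ae_eq_deriv ⟨i, Nat.lt_succ_iff.2 hi⟩
  exact e.symm.trans ((Lp.coeFn_smul _ _).trans
    ((u.coe_ae_eq_deriv ⟨i, Nat.lt_succ_iff.2 hi⟩).const_smul c))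

/-- The element of `W_p^k` given by a concrete function. -/
def mk (y : ℝ → ℂ) (hy : MemSobolev a b p k y) : Sobolev a b p k :=
  ⟨WithLp.toLp 1 fun i => (hy.memLp_iteratedDerivWithin hab.out (Nat.lt_succ_iff.1 i.2)).toLp _,
    y, hy, fun i => MemLp.coeFn_toLp
      (hy.memLp_iteratedDerivWithin hab.out (Nat.lt_succ_iff.1 i.2))⟩

theorem mk_ae_eq (y : ℝ → ℂ) (hy : MemSobolev a b p k y) :
    (mk y hy).1 0 =ᵐ[volume.restrict (Icc a b)] y := by
  refine (MemLp.coeFn_toLp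
    (hy.memLp_iteratedDerivWithin (i := 0) hab.out (Nat.zero_le k))).trans ?_
  simp

/-- Elements of `W_p^k` that agree almost everywhere are equal. -/
theorem ext_ae {u v : Sobolev a b p k} (h : u.1 0 =ᵐ[volume.restrict (Icc a b)] v.1 0) :
    u = v := by
  have hu : u.1 0 =ᵐ[volume.restrict (Icc a b)] u.rep := by
    simpa [deriv] using u.coe_ae_eq_deriv 0
  have hv : v.1 0 =ᵐ[volume.restrict (Icc a b)] v.rep := by
    simpa [deriv] using v.coe_ae_eq_deriv 0
  have h' := (hu.symm.trans h).trans hv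
  apply Subtype.ext
  ext1 i
  apply Lp.ext
  exact (u.coe_ae_eq_deriv i).trans ((MemSobolev.iteratedDerivWithin_ae_congr hab.out
    u.memSobolev_rep v.memSobolev_rep h' (Nat.lt_succ_iff.1 i.2)).trans (v.coe_ae_eq_deriv i).symm)

end Sobolev

namespace BVP

variable {a b : ℝ} [hab : Fact (a < b)] {p : ℝ≥0∞} [Fact (1 ≤ p)] {m n r l : ℕ}

/-- The `i`-th component of `(Ly)(t) = y^(r)(t) + ∑_{j < r} A_j(t) y^(j)(t)`. -/
def diffExpr (A : Fin r → Matrix (Fin m) (Fin m) (Sobolev a b p n))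
    (y : Fin m → Sobolev a b p (n + r)) (i : Fin m) (t : ℝ) : ℂ :=
  (y i).deriv r t + ∑ j : Fin r, ∑ s : Fin m, (A j i s).rep t * (y s).deriv j t

theorem memSobolev_diffExpr (A : Fin r → Matrix (Fin m) (Fin m) (Sobolev a b p n))
    (y : Fin m → Sobolev a b p (n + r)) (i : Fin m) :
    MemSobolev a b p n (diffExpr A y i) := by
  have e : diffExpr A y i = (y i).deriv r +
      ∑ j : Fin r, ∑ s : Fin m, (A j i s).rep * (y s).deriv j := by
    funext t; simp [diffExpr]
  rw [e]
  refine MemSobolev.add hab.out ((y i).memSobolev_rep.iteratedDerivWithin hab.out)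
    (MemSobolev.sum _ hab.out fun j _ => MemSobolev.sum _ hab.out fun s _ => ?_)
  refine MemSobolev.mul hab.out (A j i s).memSobolev_rep
    (MemSobolev.iteratedDerivWithin hab.out (MemSobolev.of_le hab.out ?_ (y s).memSobolev_rep))
  have := j.2
  omega

/-- The linear operator `L : (W_p^{n+r})^m → (W_p^n)^m`,
`Ly = y^(r) + A_{r-1} y^(r-1) + … + A_0 y`. -/
def L (A : Fin r → Matrix (Fin m) (Fin m) (Sobolev a b p n)) :
    (Fin m → Sobolev a b p (n + r)) →ₗ[ℂ] (Fin m → Sobolev a b p n) where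
  toFun y i := Sobolev.mk (diffExpr A y i) (memSobolev_diffExpr A y i)
  map_add' y z := by
    funext i
    refine Sobolev.ext_ae ((Sobolev.mk_ae_eq _ _).trans ?_)
    refine Filter.EventuallyEq.trans ?_ ((Lp.coeFn_add _ _).trans
      ((Sobolev.mk_ae_eq _ (memSobolev_diffExpr A y i)).add
        (Sobolev.mk_ae_eq _ (memSobolev_diffExpr A z i)))).symm
    have h : ∀ s : Fin m, ∀ j : Fin r, _ := fun s j =>
      Sobolev.deriv_add_ae (y s) (z s) (i := j) (by have := j.2; omega)
    filter_upwards [Sobolev.deriv_add_ae (y i) (z i) (i := r) (by omega),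
      ae_all_iff.2 fun s => ae_all_iff.2 (h s)] with t h1 h2
    simp only [Pi.add_apply] at h1 h2
    simp only [diffExpr, Pi.add_apply, h1, h2, mul_add, Finset.sum_add_distrib]
    ring
  map_smul' c y := by
    funext i
    refine Sobolev.ext_ae ((Sobolev.mk_ae_eq _ _).trans ?_)
    refine Filter.EventuallyEq.trans ?_ ((Lp.coeFn_smul _ _).trans
      ((Sobolev.mk_ae_eq _ (memSobolev_diffExpr A y i)).const_smul c)).symm
    have h : ∀ s : Fin m, ∀ j : Fin r, _ := fun s j =>
      Sobolev.deriv_smul_ae c (y s) (i := j) (by have := j.2; omega)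
    filter_upwards [Sobolev.deriv_smul_ae c (y i) (i := r) (by omega),
      ae_all_iff.2 fun s => ae_all_iff.2 (h s)] with t h1 h2
    simp only [Pi.smul_apply, smul_eq_mul] at h1 h2
    simp only [diffExpr, Pi.smul_apply, smul_eq_mul, h1, h2, mul_add, Finset.mul_sum]
    congr 1
    refine Finset.sum_congr rfl fun j _ => Finset.sum_congr rfl fun s _ => ?_
    ring

/-- The operator `(L, B) : (W_p^{n+r})^m → (W_p^n)^m × ℂ^l`. -/
def operator (A : Fin r → Matrix (Fin m) (Fin m) (Sobolev a b p n))
    (B : (Fin m → Sobolev a b p (n + r)) →L[ℂ] (Fin l → ℂ)) :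
    (Fin m → Sobolev a b p (n + r)) →ₗ[ℂ] (Fin m → Sobolev a b p n) × (Fin l → ℂ) :=
  (L A).prod (B : (Fin m → Sobolev a b p (n + r)) →ₗ[ℂ] (Fin l → ℂ))

/-- A linear operator between topological vector spaces is invertible if it is a linear homeomorphism, that is, it is
bounded, bijective, and has a bounded inverse. -/
def IsInvertible {X Y : Type*} [AddCommGroup X] [Module ℂ X] [TopologicalSpace X]
    [AddCommGroup Y] [Module ℂ Y] [TopologicalSpace Y] (T : X →ₗ[ℂ] Y) : Prop :=
  ∃ e : X ≃L[ℂ] Y, ∀ x, e x = T x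

/-- `Y_0, …, Y_{r-1} ∈ (W_p^{n+r})^{m×m}` solve the matrix Cauchy problems
`Y_k^(r) + ∑_{j < r} A_j Y_k^(j) = 0`, `Y_k^(q)(a) = δ_{k,q} I_m` for `q < r`. -/
def IsCauchySystem (A : Fin r → Matrix (Fin m) (Fin m) (Sobolev a b p n))
    (Y : Fin r → Matrix (Fin m) (Fin m) (Sobolev a b p (n + r))) : Prop :=
  ∀ k : Fin r,
    (∀ c : Fin m, L A (fun i => Y k i c) = 0) ∧
    ∀ q : Fin r, (Matrix.of fun i c => (Y k i c).deriv q a) =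
      if k = q then (1 : Matrix (Fin m) (Fin m) ℂ) else 0

/-- The block matrix `([BY_0], …, [BY_{r-1}]) ∈ ℂ^{l × mr}`, where the `c`-th column of the `l × m`
block `[BY_k]` is the value of `B` at the `c`-th column of `Y_k`. Thus column `k * m + c` of the
block matrix is `B` applied to column `c` of `Y_k`. -/
def charMatrix (B : (Fin m → Sobolev a b p (n + r)) →L[ℂ] (Fin l → ℂ))
    (Y : Fin r → Matrix (Fin m) (Fin m) (Sobolev a b p (n + r))) :
    Matrix (Fin l) (Fin (m * r)) ℂ :=
  Matrix.of fun i q =>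
    let kc : Fin r × Fin m := finProdFinEquiv.symm (Fin.cast (Nat.mul_comm m r) q)
    B (fun s => Y kc.1 s kc.2) i

end BVP

end

/-! The heart of the matter is the Cauchy problem: `y ↦ (Ly, (y^(j)(a))_{j<r})` is a bijection of
`(W_p^{n+r})^m` onto `(W_p^n)^m × ℂ^{mr}` (`L_deriv_injective`, `exists_L_eq_deriv_eq`). To see
this, pass to the first order system for `(y, …, y^(r-1))`. Its coefficients are merely integrable,
so it is solved in integrated form: a high iterate of the Picard operator is a contraction
(`caratheodory_existsUnique`). A bootstrap then shows that the solution has the full Sobolev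
regularity.

Hence the Cauchy system exists and is unique, `L` is onto, and the columns of `Y_0, …, Y_{r-1}` form
a basis of `ker L`. Since `L` is onto, `(L, B)` is bijective exactly when `B` maps `ker L`
bijectively onto `ℂ^l`. In the basis above that restriction of `B` has matrix `M(L, B)`, and a
matrix acts bijectively only if it is square with nonzero determinant.

Boundedness comes from completeness: `W_p^k` is closed in a product of `L_p` spaces, `L` is
continuous by the closed graph theorem, and a bijective `(L, B)` has a bounded inverse by the open
mapping theorem. -/

/-! ### Absolutely continuous functions and their primitives -/

theorem AbsolutelyContinuousOnInterval.of_dist_le {X Y : Type*} [PseudoMetricSpace X]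
    [PseudoMetricSpace Y] {f : ℝ → X} {g : ℝ → Y} {a b : ℝ}
    (hg : AbsolutelyContinuousOnInterval g a b)
    (h : ∀ x ∈ uIcc a b, ∀ y ∈ uIcc a b, dist (f x) (f y) ≤ dist (g x) (g y)) :
    AbsolutelyContinuousOnInterval f a b := by
  rw [absolutelyContinuousOnInterval_iff] at hg ⊢
  intro ε hε
  obtain ⟨δ, hδ, H⟩ := hg ε hε
  exact ⟨δ, hδ, fun E hE hl => (Finset.sum_le_sum fun i hi =>
    h _ (hE.1 i hi).1 _ (hE.1 i hi).2).trans_lt (H E hE hl)⟩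

/-- Increments of the primitive of `f` are dominated by those of the real primitive of `‖f‖`. -/
theorem IntervalIntegrable.absolutelyContinuousOnInterval_integral {E : Type*}
    [NormedAddCommGroup E] [NormedSpace ℝ E] {f : ℝ → E} {a b : ℝ}
    (hf : IntervalIntegrable f volume a b) :
    AbsolutelyContinuousOnInterval (fun t => ∫ s in a..t, f s) a b := by
  refine (hf.norm.absolutelyContinuousOnInterval_intervalIntegral left_mem_uIcc).of_dist_le ?_
  intro x hx y hy
  have hs : ∀ {z}, z ∈ uIcc a b → IntervalIntegrable f volume a z := fun hz =>
    hf.mono_set (uIcc_subset_uIcc left_mem_uIcc hz)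
  rw [dist_eq_norm, dist_eq_norm, intervalIntegral.integral_interval_sub_left (hs hx) (hs hy),
    intervalIntegral.integral_interval_sub_left (hs hx).norm (hs hy).norm, Real.norm_eq_abs]
  exact intervalIntegral.norm_integral_le_abs_integral_norm

theorem ae_derivWithin_integral_eq {f : ℝ → ℂ} {a b : ℝ} (hab : a < b)
    (hf : IntervalIntegrable f volume a b) (c : ℂ) :
    derivWithin (fun t => c + ∫ s in a..t, f s) (Icc a b) =ᵐ[volume.restrict (Icc a b)] f := by
  rw [Filter.EventuallyEq, ae_restrict_iff' measurableSet_Icc]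
  filter_upwards [hf.ae_hasDerivAt_integral] with x hx hx'
  rw [uIcc_of_le hab.le] at hx
  exact ((hx hx' a (left_mem_Icc.2 hab.le)).const_add c).hasDerivWithinAt.derivWithin
    (uniqueDiffOn_Icc hab x hx')

theorem hasDerivWithinAt_integral_of_continuousOn {f : ℝ → ℂ} {a b : ℝ}
    (hf : ContinuousOn f (Icc a b)) (c : ℂ) {t : ℝ} (ht : t ∈ Icc a b) :
    HasDerivWithinAt (fun t => c + ∫ s in a..t, f s) (f t) (Icc a b) t := by
  have : Fact (t ∈ Icc a b) := ⟨ht⟩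
  refine HasDerivWithinAt.const_add c ?_
  refine intervalIntegral.integral_hasDerivWithinAt_right
    ((hf.mono (Icc_subset_Icc_right ht.2)).intervalIntegrable_of_Icc ht.1) ?_ (hf t ht)
  exact hf.stronglyMeasurableAtFilter_nhdsWithin measurableSet_Icc t

theorem ae_eq_integral_congr {f g : ℝ → ℂ} {a b t : ℝ} (h : f =ᵐ[volume.restrict (Icc a b)] g)
    (ht : t ∈ Icc a b) : ∫ s in a..t, f s = ∫ s in a..t, g s := by
  refine intervalIntegral.integral_congr_ae ?_
  rw [Filter.EventuallyEq, ae_restrict_iff' measurableSet_Icc] at h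
  filter_upwards [h] with x hx hx'
  rw [uIoc_of_le ht.1] at hx'
  exact hx ⟨hx'.1.le, hx'.2.trans ht.2⟩

theorem AbsolutelyContinuousOnInterval.eq_add_integral_derivWithin {f : ℝ → ℂ} {a b : ℝ}
    (hab : a < b) (hf : AbsolutelyContinuousOnInterval f a b)
    (hf' : IntervalIntegrable (derivWithin f (Icc a b)) volume a b) {t : ℝ} (ht : t ∈ Icc a b) :
    f t = f a + ∫ s in a..t, derivWithin f (Icc a b) s := by
  -- The difference of `f` and the primitive of its derivative is absolutely continuous with
  -- derivative zero almost everywhere, hence constant. The endpoints are discarded because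
  -- one-sided and two-sided derivatives agree only in the interior.
  obtain ⟨C, hC⟩ := (hf.sub hf'.absolutelyContinuousOnInterval_integral).const_of_ae_hasDerivAt_zero
    (by
      have h1 := (ae_restrict_iff' measurableSet_Icc).1 (MemSobolev.ac_ae_differentiable hab hf)
      have h2 : ∀ c : ℝ, ∀ᵐ x, x ≠ c := fun c => by simp [ae_iff, measure_singleton]
      filter_upwards [hf'.ae_hasDerivAt_integral, h1, h2 a, h2 b] with x hx hx1 ha hb hx'
      have hxI : x ∈ Icc a b := by rwa [uIcc_of_le hab.le] at hx'
      have hd := (hx1 hxI).2.hasDerivWithinAt.hasDerivAt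
        (Icc_mem_nhds (lt_of_le_of_ne hxI.1 ha.symm) (lt_of_le_of_ne hxI.2 hb))
      simpa using! hd.sub (hx hx' a left_mem_uIcc))
  rw [uIcc_of_le hab.le] at hC
  have h1 := hC t ht
  have h2 := hC a (left_mem_Icc.2 hab.le)
  simp only [Pi.sub_apply, intervalIntegral.integral_same, sub_zero] at h1 h2
  rw [h2, ← h1]
  ring

/-! ### Primitives and products of Sobolev functions -/

namespace MemSobolev

variable {a b : ℝ} {p : ℝ≥0∞} {k : ℕ} {f g : ℝ → ℂ}

theorem intervalIntegrable (hab : a < b) (hp : 1 ≤ p) (hf : MemSobolev a b p k f) :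
    IntervalIntegrable f volume a b := by
  have h0 : MemLp f p (volume.restrict (Icc a b)) := of_le (k := 0) hab (Nat.zero_le k) hf
  exact (intervalIntegrable_iff_integrableOn_Icc_of_le hab.le).2 (h0.integrable hp)

theorem absolutelyContinuous (hab : a < b) (hf : MemSobolev a b p (k + 1) f) :
    AbsolutelyContinuousOnInterval f a b := by
  simpa using (of_le (k := 1) hab (by omega) hf).2.1

theorem eq_add_integral (hab : a < b) (hp : 1 ≤ p) (hf : MemSobolev a b p (k + 1) f) {t : ℝ}
    (ht : t ∈ Icc a b) : f t = f a + ∫ s in a..t, _root_.derivWithin f (Icc a b) s :=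
  (hf.absolutelyContinuous hab).eq_add_integral_derivWithin hab
    ((hf.derivWithin hab).intervalIntegrable hab hp) ht

theorem integral (hab : a < b) (hp : 1 ≤ p) (hg : MemSobolev a b p k g) (c : ℂ) :
    MemSobolev a b p (k + 1) (fun t => c + ∫ s in a..t, g s) := by
  have hi := hg.intervalIntegrable hab hp
  cases k with
  | zero =>
    have hac : AbsolutelyContinuousOnInterval (fun t => c + ∫ s in a..t, g s) a b :=
      hi.absolutelyContinuousOnInterval_integral.of_dist_le fun x _ y _ => by simp
    refine ⟨?_, by simpa using hac, ?_⟩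
    · simpa using ac_continuousOn hab hac
    · refine (memLp_congr_ae ?_).2 hg
      simpa [iteratedDerivWithin_one] using ae_derivWithin_integral_eq hab hi c
  | succ k =>
    have hd := fun t ht => hasDerivWithinAt_integral_of_continuousOn hg.continuousOn c
      (t := t) ht
    refine (succ_succ_iff hab).2 ⟨fun t ht => (hd t ht).differentiableWithinAt,
      hg.congr hab fun t ht => ((hd t ht).derivWithin (uniqueDiffOn_Icc hab t ht)).symm⟩

/-- A chain of functions, each a primitive of the next one almost everywhere and ending in `W_p^n`,
consists of the derivatives of a single function. -/
theorem exists_of_chain (hab : a < b) (hp : 1 ≤ p) {n : ℕ} (v : ℕ → ℝ → ℂ) (c : ℕ → ℂ)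
    (hv : MemSobolev a b p n (v k))
    (h : ∀ i < k, v i =ᵐ[volume.restrict (Icc a b)] fun t => c i + ∫ s in a..t, v (i + 1) s) :
    ∃ y, MemSobolev a b p (n + k) y ∧ ∀ i ≤ k,
      _root_.iteratedDerivWithin i y (Icc a b) =ᵐ[volume.restrict (Icc a b)] v i := by
  induction k generalizing v c with
  | zero =>
    refine ⟨v 0, hv, fun i hi => ?_⟩
    obtain rfl : i = 0 := by omega
    simp
  | succ k ih =>
    -- `z` realizes the shifted chain starting at `v 1`; its primitive with constant `c 0` then
    -- realizes the whole chain.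
    obtain ⟨z, hz, hzv⟩ := ih (fun i => v (i + 1)) (fun i => c (i + 1)) hv
      fun i hi => h (i + 1) (by omega)
    have hz0 : z =ᵐ[volume.restrict (Icc a b)] v 1 := by simpa using hzv 0 (Nat.zero_le k)
    have hy := integral hab hp hz (c 0)
    refine ⟨_, hy, fun i hi => ?_⟩
    cases i with
    | zero =>
      rw [iteratedDerivWithin_zero]
      refine Filter.EventuallyEq.trans (ae_of_eqOn fun t ht => ?_) (h 0 (by omega)).symm
      simp only [ae_eq_integral_congr hz0 ht, zero_add]
    | succ i =>
      rw [iteratedDerivWithin_succ']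
      refine (iteratedDerivWithin_ae_congr hab (hy.derivWithin hab) hz
        (ae_derivWithin_integral_eq hab (hz.intervalIntegrable hab hp) _) (by omega)).trans
        (hzv i (by omega))

/-- For `k ≥ 1` the space `W_p^k` is an algebra. -/
theorem mul_succ (hab : a < b) (hp : 1 ≤ p) (hf : MemSobolev a b p (k + 1) f)
    (hg : MemSobolev a b p (k + 1) g) : MemSobolev a b p (k + 1) (f * g) := by
  have hf' := hf.derivWithin hab
  have hg' := hg.derivWithin hab
  -- In each product one factor lies in `W_p^{k+1}`, so `mul` applies. The product `f * g` is a
  -- primitive of this sum, which gains the missing order.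
  have hs : MemSobolev a b p k (_root_.derivWithin f (Icc a b) * g +
      f * _root_.derivWithin g (Icc a b)) :=
    add hab (mul hab hf' hg) (by rw [mul_comm f]; exact mul hab hg' hf)
  have hfac := hf.absolutelyContinuous hab
  have hgac := hg.absolutelyContinuous hab
  have hac : AbsolutelyContinuousOnInterval (f * g) a b := by simpa using hfac.smul hgac
  have hd : _root_.derivWithin (f * g) (Icc a b) =ᵐ[volume.restrict (Icc a b)]
      _root_.derivWithin f (Icc a b) * g + f * _root_.derivWithin g (Icc a b) := by
    filter_upwards [ac_ae_differentiable hab hfac, ac_ae_differentiable hab hgac] with x hx hy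
    simp [derivWithin_mul hx.2 hy.2]
  refine (integral hab hp hs ((f * g) a)).congr hab fun t ht => ?_
  rw [hac.eq_add_integral_derivWithin hab ?_ ht, ae_eq_integral_congr hd ht]
  have := hs.intervalIntegrable hab hp
  rw [intervalIntegrable_iff_integrableOn_Icc_of_le hab.le] at this ⊢
  exact (integrable_congr hd).2 this

end MemSobolev

/-! ### Carathéodory integral equations -/

/-- With `φ` the primitive of `k`, the power `φ^(n+1)` is absolutely continuous with derivative
`(n+1) φ^n k` almost everywhere. This produces the factorials in the Picard estimate. -/
theorem intervalIntegral.integral_pow_integral_mul {k : ℝ → ℝ} {a b : ℝ}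
    (hk : IntervalIntegrable k volume a b) (n : ℕ) :
    ∫ s in a..b, (∫ u in a..s, k u) ^ n * k s = (∫ u in a..b, k u) ^ (n + 1) / (n + 1) := by
  have hφ : AbsolutelyContinuousOnInterval (fun t => ∫ u in a..t, k u) a b :=
    hk.absolutelyContinuousOnInterval_intervalIntegral left_mem_uIcc
  have hpow : ∀ j : ℕ,
      AbsolutelyContinuousOnInterval (fun t => (∫ u in a..t, k u) ^ (j + 1)) a b := by
    intro j
    induction j with
    | zero => simpa using hφ
    | succ j ih =>
      have := ih.fun_mul hφ
      simpa only [← pow_succ] using this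
  have h := (hpow n).integral_deriv_eq_sub
  have hd : ∫ s in a..b, _root_.deriv (fun t => (∫ u in a..t, k u) ^ (n + 1)) s =
      ∫ s in a..b, (n + 1) * ((∫ u in a..s, k u) ^ n * k s) := by
    refine intervalIntegral.integral_congr_ae ?_
    filter_upwards [hk.ae_hasDerivAt_integral] with s hs hs'
    have := (hs (uIoc_subset_uIcc hs') a left_mem_uIcc).pow (n + 1)
    rw [HasDerivAt.deriv (by simpa using! this)]
    ring
  rw [hd, intervalIntegral.integral_const_mul] at h
  have : (n : ℝ) + 1 ≠ 0 := by positivity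
  rw [eq_div_iff this, mul_comm, h]
  simp

/-- Existence and uniqueness for Carathéodory integral equations with a globally Lipschitz right-hand
side, the Lipschitz constant being an integrable function of time. -/
theorem caratheodory_existsUnique {E : Type*} [NormedAddCommGroup E] [NormedSpace ℝ E]
    [CompleteSpace E] {a b : ℝ} (hab : a ≤ b) (F : ℝ → E → E) (k : ℝ → ℝ)
    (hk : IntervalIntegrable k volume a b) (hk0 : ∀ s, 0 ≤ k s)
    (hF : ∀ x : ℝ → E, ContinuousOn x (Icc a b) →
      IntervalIntegrable (fun s => F s (x s)) volume a b)
    (hL : ∀ s x y, ‖F s x - F s y‖ ≤ k s * ‖x - y‖) (c : E) :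
    ∃! x : C(Icc a b, E), ∀ t : Icc a b,
      x t = c + ∫ s in a..(t : ℝ), F s (IccExtend hab x s) := by
  have hsub : ∀ {f : ℝ → E} (t : Icc a b), IntervalIntegrable f volume a b →
      IntervalIntegrable f volume a t := fun t h =>
    h.mono_set (uIcc_subset_uIcc left_mem_uIcc (by rw [uIcc_of_le hab]; exact t.2))
  have hsubR : ∀ {f : ℝ → ℝ} (t : Icc a b), IntervalIntegrable f volume a b →
      IntervalIntegrable f volume a t := fun t h =>
    h.mono_set (uIcc_subset_uIcc left_mem_uIcc (by rw [uIcc_of_le hab]; exact t.2))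
  have hx : ∀ x : C(Icc a b, E), IntervalIntegrable (fun s => F s (IccExtend hab x s)) volume a b :=
    fun x => hF _ (x.continuous.Icc_extend' (h := hab)).continuousOn
  have hcont : ∀ x : C(Icc a b, E),
      Continuous fun t : Icc a b => c + ∫ s in a..(t : ℝ), F s (IccExtend hab x s) := by
    intro x
    refine continuous_const.add ?_
    have := (hx x).absolutelyContinuousOnInterval_integral.continuousOn
    rw [uIcc_of_le hab] at this
    exact this.domRestrict
  let P : C(Icc a b, E) → C(Icc a b, E) := fun x => ⟨_, hcont x⟩
  have hP : ∀ x t, P x t = c + ∫ s in a..(t : ℝ), F s (IccExtend hab x s) := fun _ _ => rfl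
  set φ : ℝ → ℝ := fun t => ∫ u in a..t, k u with hφ
  have hφc : ContinuousOn φ (uIcc a b) :=
    (hk.absolutelyContinuousOnInterval_intervalIntegral left_mem_uIcc).continuousOn
  -- Each further iteration integrates `φ^n k / n!`, which gives `φ^(n+1) / (n+1)!`. Since these
  -- bounds tend to zero, some iterate contracts on all of `[a,b]`, however large `∫ k` is.
  have hiter : ∀ (n : ℕ) (x y : C(Icc a b, E)) (t : Icc a b),
      ‖P^[n] x t - P^[n] y t‖ ≤ φ t ^ n / n.factorial * ‖x - y‖ := by
    intro n x y
    induction n with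
    | zero => intro t; simpa using (x - y).norm_coe_le_norm t
    | succ n ih =>
      intro t
      rw [Function.iterate_succ_apply', Function.iterate_succ_apply', hP, hP,
        add_sub_add_left_eq_sub, ← intervalIntegral.integral_sub (hsub t (hx _)) (hsub t (hx _))]
      have hint : IntervalIntegrable
          (fun s => (φ s ^ n * k s) * (‖x - y‖ / n.factorial)) volume a b :=
        (hk.continuousOn_mul (hφc.pow n)).mul_const _
      refine (intervalIntegral.norm_integral_le_of_norm_le t.2.1 ?_ (hsubR t hint)).trans_eq ?_
      · refine Filter.Eventually.of_forall fun s hs => ?_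
        have hsI : s ∈ Icc a b := ⟨hs.1.le, hs.2.trans t.2.2⟩
        have hi := ih ⟨s, hsI⟩
        rw [← IccExtend_of_mem hab (P^[n] x) hsI, ← IccExtend_of_mem hab (P^[n] y) hsI] at hi
        refine (hL _ _ _).trans ((mul_le_mul_of_nonneg_left hi (hk0 s)).trans_eq ?_)
        simp only
        ring
      · rw [intervalIntegral.integral_mul_const,
          intervalIntegral.integral_pow_integral_mul (hsubR t hk), Nat.factorial_succ]
        push_cast
        field_simp
        simp only [hφ]
        ring
  obtain ⟨n, hn⟩ : ∃ n : ℕ, φ b ^ n / n.factorial < 1 :=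
    ((FloorSemiring.tendsto_pow_div_factorial_atTop (φ b)).eventually_lt_const one_pos).exists
  have hφ0 : ∀ t ∈ Icc a b, 0 ≤ φ t := fun t ht =>
    intervalIntegral.integral_nonneg ht.1 fun s _ => hk0 s
  have hφm : ∀ t ∈ Icc a b, φ t ≤ φ b := fun t ht =>
    intervalIntegral.integral_mono_interval le_rfl ht.1 ht.2
      (Filter.Eventually.of_forall hk0) hk
  have hb0 : 0 ≤ φ b ^ n / n.factorial :=
    div_nonneg (pow_nonneg (hφ0 b (right_mem_Icc.2 hab)) n) (by positivity)
  have hcontr : ContractingWith ⟨_, hb0⟩ P^[n] := by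
    refine ⟨hn, LipschitzWith.of_dist_le_mul fun x y => ?_⟩
    rw [dist_eq_norm, dist_eq_norm]
    refine (ContinuousMap.norm_le _ (mul_nonneg hb0 (norm_nonneg _))).2 fun t => ?_
    refine (hiter n x y t).trans (mul_le_mul_of_nonneg_right ?_ (norm_nonneg _))
    have := pow_le_pow_left₀ (hφ0 t t.2) (hφm t t.2) n
    exact div_le_div_of_nonneg_right this (by positivity)
  -- `P` commutes with its iterate, so it preserves the unique fixed point of the iterate.
  have hfix := hcontr.isFixedPt_fixedPoint_iterate
  refine ⟨hcontr.fixedPoint, fun t => ?_, fun y hy => ?_⟩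
  · exact (DFunLike.congr_fun hfix t).symm
  · have hyP : Function.IsFixedPt P y := ContinuousMap.ext fun t => (hy t).symm
    exact hcontr.fixedPoint_unique (hyP.iterate n)

/-! ### Completeness of `W_p^k` and continuity of `L` -/

section

open Filter
open scoped Topology

theorem MeasureTheory.Lp.exists_subseq_tendsto_ae {α E : Type*} [MeasurableSpace α]
    {μ : Measure α} [NormedAddCommGroup E] {p : ℝ≥0∞} [Fact (1 ≤ p)] {f : ℕ → Lp E p μ}
    {g : Lp E p μ} (h : Tendsto f atTop (𝓝 g)) :
    ∃ ns : ℕ → ℕ, StrictMono ns ∧ ∀ᵐ x ∂μ, Tendsto (fun i => f (ns i) x) atTop (𝓝 (g x)) :=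
  (tendstoInMeasure_of_tendsto_Lp h).exists_seq_tendsto_ae

/-- Finitely many convergent sequences in `L_p` have a common almost everywhere convergent
subsequence. -/
theorem MeasureTheory.Lp.exists_common_subseq_tendsto_ae {α E ι : Type*} [MeasurableSpace α]
    {μ : Measure α} [NormedAddCommGroup E] {p : ℝ≥0∞} [Fact (1 ≤ p)] (s : Finset ι)
    {f : ι → ℕ → Lp E p μ} {g : ι → Lp E p μ} (h : ∀ i, Tendsto (f i) atTop (𝓝 (g i))) :
    ∃ ns : ℕ → ℕ, StrictMono ns ∧
      ∀ i ∈ s, ∀ᵐ x ∂μ, Tendsto (fun j => f i (ns j) x) atTop (𝓝 (g i x)) := by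
  classical
  induction s using Finset.induction_on with
  | empty => exact ⟨id, strictMono_id, by simp⟩
  | insert i s hi ih =>
    obtain ⟨ns, hns, H⟩ := ih
    obtain ⟨ms, hms, H'⟩ := exists_subseq_tendsto_ae ((h i).comp hns.tendsto_atTop)
    refine ⟨ns ∘ ms, hns.comp hms, fun j hj => ?_⟩
    rcases Finset.mem_insert.1 hj with rfl | hj
    · exact H'
    · filter_upwards [H j hj] with x hx using hx.comp hms.tendsto_atTop

theorem MeasureTheory.Lp.tendsto_intervalIntegral {a b : ℝ} {p : ℝ≥0∞} [hp : Fact (1 ≤ p)]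
    {f : ℕ → Lp ℂ p (volume.restrict (Icc a b))} {g : Lp ℂ p (volume.restrict (Icc a b))}
    (h : Tendsto f atTop (𝓝 g)) {t : ℝ} (ht : t ∈ Icc a b) :
    Tendsto (fun j => ∫ s in a..t, f j s) atTop (𝓝 (∫ s in a..t, g s)) := by
  have hsub : (volume.restrict (Icc a b)).restrict (Ioc a t) = volume.restrict (Ioc a t) :=
    Measure.restrict_restrict_of_subset fun s hs => ⟨hs.1.le, hs.2.trans ht.2⟩
  simp only [intervalIntegral.integral_of_le ht.1]
  rw [← hsub]
  refine tendsto_setIntegral_of_L1' _ (Lp.aestronglyMeasurable g)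
    (Eventually.of_forall fun j => (Lp.memLp (f j)).integrable hp.out) ?_ _
  have h1 := (Lp.tendsto_Lp_iff_tendsto_eLpNorm' f g).1 h
  obtain ⟨C, hC, hle⟩ : ∃ C : ℝ≥0∞, C ≠ ∞ ∧ ∀ j, eLpNorm (⇑(f j) - ⇑g) 1
      (volume.restrict (Icc a b)) ≤ eLpNorm (⇑(f j) - ⇑g) p (volume.restrict (Icc a b)) * C := by
    refine ⟨_, ?_, fun j => eLpNorm_le_eLpNorm_mul_rpow_measure_univ hp.out
      ((Lp.aestronglyMeasurable _).sub (Lp.aestronglyMeasurable _))⟩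
    refine ENNReal.rpow_ne_top_of_nonneg ?_ (measure_ne_top _ _)
    -- The Hölder constant is the total mass to the power `1 - 1/p`. For `p = ∞` the convention
    -- `p.toReal = 0` gives exponent `1`.
    rcases eq_or_ne p ∞ with rfl | hp'
    · simp
    · have : 1 ≤ p.toReal := by
        simpa using (ENNReal.toReal_le_toReal (by simp) hp').2 hp.out
      simp only [ENNReal.toReal_one, div_one, one_div, sub_nonneg]
      exact inv_le_one_of_one_le₀ this
  refine tendsto_of_tendsto_of_tendsto_of_le_of_le tendsto_const_nhds ?_ (fun _ => zero_le) hle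
  simpa using ENNReal.Tendsto.mul_const h1 (Or.inr hC)

namespace Sobolev

variable {a b : ℝ} [hab : Fact (a < b)] {p : ℝ≥0∞} [hp : Fact (1 ≤ p)] {k : ℕ}

theorem memSobolev_deriv {i : ℕ} (u : Sobolev a b p (k + i)) :
    MemSobolev a b p k (u.deriv i) :=
  u.memSobolev_rep.iteratedDerivWithin hab.out

theorem continuousOn_deriv (u : Sobolev a b p k) {i : ℕ} (hi : i < k) :
    ContinuousOn (u.deriv i) (Icc a b) := by
  obtain ⟨j, rfl⟩ : ∃ j, k = (j + 1) + i := ⟨k - i - 1, by omega⟩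
  exact (memSobolev_deriv u).continuousOn

theorem deriv_eq_add_integral (u : Sobolev a b p k) {i : ℕ} (hi : i < k) {t : ℝ}
    (ht : t ∈ Icc a b) : u.deriv i t = u.deriv i a + ∫ s in a..t, u.deriv (i + 1) s := by
  obtain ⟨j, rfl⟩ : ∃ j, k = (j + 1) + i := ⟨k - i - 1, by omega⟩
  have := (memSobolev_deriv u).eq_add_integral hab.out hp.out ht
  simpa only [deriv, iteratedDerivWithin_succ] using this

/-- Along a subsequence the derivatives converge almost everywhere and their integrals converge, so
`y^(i)(t) = y^(i)(a) + ∫ y^(i+1)` passes to the limit. The limit tuple is thus a chain of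
primitives, to which `MemSobolev.exists_of_chain` applies. -/
theorem isClosed_sobolevSubmodule :
    IsClosed (sobolevSubmodule a b p k : Set (PiLp 1 fun _ : Fin (k + 1) =>
      Lp ℂ p (volume.restrict (Icc a b)))) := by
  refine isClosed_of_closure_subset fun u hu => ?_
  obtain ⟨w, hw, hwu⟩ := mem_closure_iff_seq_limit.1 hu
  let w' : ℕ → Sobolev a b p k := fun j => ⟨w j, hw j⟩
  have hcomp : ∀ i, Tendsto (fun j => w j i) atTop (𝓝 (u i)) := fun i =>
    ((PiLp.continuous_apply 1 _ i).tendsto u).comp hwu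
  obtain ⟨ns, hns, hae⟩ := Lp.exists_common_subseq_tendsto_ae Finset.univ hcomp
  -- Chains are indexed by `ℕ`; the value `0` beyond index `k` is never used.
  let v : ℕ → ℝ → ℂ := fun i => if h : i < k + 1 then u ⟨i, h⟩ else 0
  have hv : ∀ (i : ℕ) (h : i < k + 1), v i = u ⟨i, h⟩ := fun i h => dif_pos h
  have hchain : ∀ i : ℕ, ∃ c : ℂ, i < k →
      v i =ᵐ[volume.restrict (Icc a b)] fun t => c + ∫ s in a..t, v (i + 1) s := by
    intro i
    by_cases hi : i < k
    swap
    · exact ⟨0, fun h => absurd h hi⟩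
    rw [hv i (by omega), hv (i + 1) (by omega)]
    have h1 : ∀ᵐ t ∂(volume.restrict (Icc a b)), t ∈ Icc a b ∧
        Tendsto (fun j => (w' (ns j)).deriv i a) atTop
          (𝓝 (u ⟨i, by omega⟩ t - ∫ s in a..t, u ⟨i + 1, by omega⟩ s)) := by
      have hrep : ∀ᵐ t ∂(volume.restrict (Icc a b)), ∀ j,
          w (ns j) ⟨i, by omega⟩ t = (w' (ns j)).deriv i t :=
        ae_all_iff.2 fun j => (w' (ns j)).coe_ae_eq_deriv ⟨i, by omega⟩
      filter_upwards [hae ⟨i, by omega⟩ (Finset.mem_univ _), hrep,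
        ae_restrict_mem measurableSet_Icc] with t ht ht' htI
      refine ⟨htI, (ht.sub ((Lp.tendsto_intervalIntegral (hcomp ⟨i + 1, by omega⟩) htI).comp
        hns.tendsto_atTop)).congr fun j => ?_⟩
      have he := ae_eq_integral_congr ((w' (ns j)).coe_ae_eq_deriv ⟨i + 1, by omega⟩) htI
      simp only [Function.comp_apply]
      rw [ht' j, deriv_eq_add_integral (w' (ns j)) hi htI]
      simp only [w'] at he ⊢
      rw [he]
      ring
    have hne : NeBot (ae (volume.restrict (Icc a b))) := by
      rw [ae_neBot, Ne, Measure.restrict_eq_zero, Real.volume_Icc]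
      simpa using hab.out
    -- The sequence of initial values does not depend on `t`, so one good point `t₀` already yields
    -- the constant of integration.
    obtain ⟨t₀, -, ht₀⟩ := h1.exists
    refine ⟨u ⟨i, by omega⟩ t₀ - ∫ s in a..t₀, u ⟨i + 1, by omega⟩ s, fun _ => ?_⟩
    filter_upwards [h1] with t ht
    rw [tendsto_nhds_unique ht₀ ht.2]
    ring
  choose c hc using hchain
  have hvk : MemSobolev a b p 0 (v k) := by
    rw [hv k (by omega)]
    exact Lp.memLp _
  obtain ⟨y, hy, hyv⟩ := MemSobolev.exists_of_chain (k := k) hab.out hp.out v c hvk hc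
  refine ⟨y, by simpa using hy, fun i => ?_⟩
  have := hyv i (by omega)
  rw [hv i i.2] at this
  exact this.symm

instance : CompleteSpace (Sobolev a b p k) :=
  isClosed_sobolevSubmodule.isComplete.completeSpace_coe

theorem coe_zero_ae_eq_rep (u : Sobolev a b p k) :
    u.1 0 =ᵐ[volume.restrict (Icc a b)] u.rep := by
  simpa [deriv] using u.coe_ae_eq_deriv 0

end Sobolev

namespace BVP

variable {a b : ℝ} [hab : Fact (a < b)] {p : ℝ≥0∞} [hp : Fact (1 ≤ p)] {m n r l : ℕ}

theorem L_coe_zero_ae_eq (A : Fin r → Matrix (Fin m) (Fin m) (Sobolev a b p n))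
    (y : Fin m → Sobolev a b p (n + r)) (i : Fin m) :
    (L A y i).1 0 =ᵐ[volume.restrict (Icc a b)] diffExpr A y i :=
  Sobolev.mk_ae_eq _ (memSobolev_diffExpr A y i)

theorem L_eq_iff (A : Fin r → Matrix (Fin m) (Fin m) (Sobolev a b p n))
    (y : Fin m → Sobolev a b p (n + r)) (f : Fin m → Sobolev a b p n) :
    L A y = f ↔ ∀ i, diffExpr A y i =ᵐ[volume.restrict (Icc a b)] (f i).rep := by
  constructor
  · rintro rfl i
    exact (L_coe_zero_ae_eq A y i).symm.trans (L A y i).coe_zero_ae_eq_rep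
  · intro h
    funext i
    exact Sobolev.ext_ae ((L_coe_zero_ae_eq A y i).trans
      ((h i).trans (f i).coe_zero_ae_eq_rep.symm))

/-- The closed graph theorem spares norm estimates for the products: if `y_j → z` and `L y_j → f`,
then along a common subsequence everything converges pointwise almost everywhere, and there `L` is a
finite combination with fixed coefficients. -/
theorem continuous_L (A : Fin r → Matrix (Fin m) (Fin m) (Sobolev a b p n)) :
    Continuous (L A) := by
  refine LinearMap.continuous_of_seq_closed_graph (𝕜 := ℂ) (E := Fin m → Sobolev a b p (n + r))
    (F := Fin m → Sobolev a b p n) (g := L A) fun y z f hy hf => ?_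
  symm
  rw [L_eq_iff]
  intro i
  have hyc : ∀ q : Fin m × Fin (n + r + 1),
      Tendsto (fun j => (y j q.1).1 q.2) atTop (𝓝 ((z q.1).1 q.2)) := fun q =>
    ((PiLp.continuous_apply 1 _ q.2).tendsto _).comp
      ((continuous_subtype_val.tendsto _).comp ((continuous_apply q.1).tendsto z |>.comp hy))
  have hfc : Tendsto (fun j => (L A (y j) i).1 0) atTop (𝓝 ((f i).1 0)) :=
    ((PiLp.continuous_apply 1 _ 0).tendsto _).comp
      ((continuous_subtype_val.tendsto _).comp ((continuous_apply i).tendsto f |>.comp hf))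
  obtain ⟨ns, hns, h1⟩ := Lp.exists_common_subseq_tendsto_ae Finset.univ hyc
  obtain ⟨ms, hms, h2⟩ := Lp.exists_subseq_tendsto_ae (hfc.comp hns.tendsto_atTop)
  have e1 : ∀ᵐ t ∂(volume.restrict (Icc a b)), ∀ q : Fin m × Fin (n + r + 1),
      (z q.1).1 q.2 t = (z q.1).deriv q.2 t :=
    ae_all_iff.2 fun q => (z q.1).coe_ae_eq_deriv q.2
  have e2 : ∀ᵐ t ∂(volume.restrict (Icc a b)), ∀ (q : Fin m × Fin (n + r + 1)) (j : ℕ),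
      (y j q.1).1 q.2 t = (y j q.1).deriv q.2 t :=
    ae_all_iff.2 fun q => ae_all_iff.2 fun j => (y j q.1).coe_ae_eq_deriv q.2
  have e3 : ∀ᵐ t ∂(volume.restrict (Icc a b)), ∀ j : ℕ,
      (L A (y j) i).1 0 t = diffExpr A (y j) i t :=
    ae_all_iff.2 fun j => L_coe_zero_ae_eq A (y j) i
  have h1' := ae_all_iff.2 fun q => h1 q (Finset.mem_univ q)
  filter_upwards [h1', h2, e1, e2, e3, (f i).coe_zero_ae_eq_rep] with t t1 t2 t3 t4 t5 t6
  have hd : ∀ (s : Fin m) (q : ℕ), q ≤ r →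
      Tendsto (fun j => (y (ns (ms j)) s).deriv q t) atTop (𝓝 ((z s).deriv q t)) := by
    intro s q hq
    have := (t1 (s, ⟨q, by omega⟩)).comp hms.tendsto_atTop
    rw [t3] at this
    exact this.congr fun j => t4 (s, ⟨q, by omega⟩) _
  rw [← t6]
  have lim1 : Tendsto (fun j => diffExpr A (y (ns (ms j))) i t) atTop (𝓝 (diffExpr A z i t)) := by
    refine (hd i r le_rfl).add (tendsto_finsetSum _ fun j _ => tendsto_finsetSum _ fun s _ => ?_)
    exact (hd s j j.2.le).const_mul _
  exact tendsto_nhds_unique lim1 (t2.congr fun j => t5 _)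

end BVP

/-! ### The companion system -/

theorem IntervalIntegrable.finset_sum' {ι E : Type*} [NormedAddCommGroup E] (s : Finset ι)
    {f : ι → ℝ → E} {a b : ℝ} (h : ∀ i ∈ s, IntervalIntegrable (f i) volume a b) :
    IntervalIntegrable (fun t => ∑ i ∈ s, f i t) volume a b := by
  simpa only [Finset.sum_fn] using IntervalIntegrable.sum s h

/-- The right-hand side of the first order system equivalent to
`y^(r) + ∑_{j < r} α_j y^(j) = g`. -/
def companion {r m : ℕ} (α : Fin r → Fin m → Fin m → ℝ → ℂ) (g : Fin m → ℝ → ℂ) (t : ℝ)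
    (x : Fin r → Fin m → ℂ) : Fin r → Fin m → ℂ := fun j i =>
  if h : (j : ℕ) + 1 < r then x ⟨j + 1, h⟩ i else g i t - ∑ q, ∑ s, α q i s t * x q s

section Companion

variable {r m : ℕ} {α : Fin r → Fin m → Fin m → ℝ → ℂ} {g : Fin m → ℝ → ℂ} {a b : ℝ}

theorem intervalIntegrable_companion_apply (hab : a ≤ b)
    (hα : ∀ q i s, IntervalIntegrable (α q i s) volume a b)
    (hg : ∀ i, IntervalIntegrable (g i) volume a b) {x : ℝ → Fin r → Fin m → ℂ}
    (hx : ContinuousOn x (Icc a b)) (j : Fin r) (i : Fin m) :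
    IntervalIntegrable (fun t => companion α g t (x t) j i) volume a b := by
  have hc : ∀ q s, ContinuousOn (fun t => x t q s) (uIcc a b) := by
    rw [uIcc_of_le hab]
    exact fun q s => continuousOn_pi.1 (continuousOn_pi.1 hx q) s
  unfold companion
  split_ifs with h
  · exact (hc _ _).intervalIntegrable
  · exact (hg i).sub (IntervalIntegrable.finset_sum' _ fun q _ =>
      IntervalIntegrable.finset_sum' _ fun s _ => (hα q i s).mul_continuousOn (hc q s))

theorem intervalIntegrable_companion (hab : a ≤ b)
    (hα : ∀ q i s, IntervalIntegrable (α q i s) volume a b)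
    (hg : ∀ i, IntervalIntegrable (g i) volume a b) {x : ℝ → Fin r → Fin m → ℂ}
    (hx : ContinuousOn x (Icc a b)) :
    IntervalIntegrable (fun t => companion α g t (x t)) volume a b := by
  rw [intervalIntegrable_iff]
  exact Integrable.of_eval fun j => Integrable.of_eval fun i =>
    intervalIntegrable_iff.1 (intervalIntegrable_companion_apply hab hα hg hx j i)

theorem integral_companion_apply (hab : a ≤ b)
    (hα : ∀ q i s, IntervalIntegrable (α q i s) volume a b)
    (hg : ∀ i, IntervalIntegrable (g i) volume a b) {x : ℝ → Fin r → Fin m → ℂ}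
    (hx : ContinuousOn x (Icc a b)) {t : ℝ} (ht : t ∈ Icc a b) (j : Fin r) (i : Fin m) :
    (∫ s in a..t, companion α g s (x s)) j i = ∫ s in a..t, companion α g s (x s) j i := by
  have h : ∀ j i, IntegrableOn (fun s => companion α g s (x s) j i) (Ioc a t) := fun j i =>
    (intervalIntegrable_iff_integrableOn_Ioc_of_le ht.1).1
      ((intervalIntegrable_companion_apply hab hα hg hx j i).mono_set
        (uIcc_subset_uIcc left_mem_uIcc (by rwa [uIcc_of_le hab])))
  simp only [intervalIntegral.integral_of_le ht.1]
  rw [eval_integral fun j => Integrable.of_eval (h j), eval_integral (h j)]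

/-- The `1` covers the rows that merely shift, the sum covers the last row; summing over all `i`
makes the constant independent of the row. -/
theorem norm_companion_sub_le (t : ℝ) (x y : Fin r → Fin m → ℂ) :
    ‖companion α g t x - companion α g t y‖ ≤
      (1 + ∑ i, ∑ q, ∑ s, ‖α q i s t‖) * ‖x - y‖ := by
  have hn : 0 ≤ ∑ i, ∑ q, ∑ s, ‖α q i s t‖ :=
    Finset.sum_nonneg fun _ _ => Finset.sum_nonneg fun _ _ => Finset.sum_nonneg fun _ _ =>
      norm_nonneg _
  have hxy : ∀ q s, ‖x q s - y q s‖ ≤ ‖x - y‖ := fun q s =>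
    (norm_le_pi_norm ((x - y) q) s).trans (norm_le_pi_norm (x - y) q)
  have h0 : 0 ≤ (1 + ∑ i, ∑ q, ∑ s, ‖α q i s t‖) * ‖x - y‖ := by positivity
  refine (pi_norm_le_iff_of_nonneg h0).2 fun j => (pi_norm_le_iff_of_nonneg h0).2 fun i => ?_
  simp only [Pi.sub_apply, companion]
  split_ifs with h
  · refine (hxy _ _).trans (le_mul_of_one_le_left (norm_nonneg _) (by linarith))
  · have e : (g i t - ∑ q, ∑ s, α q i s t * x q s) - (g i t - ∑ q, ∑ s, α q i s t * y q s) =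
        - ∑ q, ∑ s, α q i s t * (x q s - y q s) := by
      simp only [mul_sub, Finset.sum_sub_distrib]
      ring
    rw [e, norm_neg]
    calc ‖∑ q, ∑ s, α q i s t * (x q s - y q s)‖
        ≤ ∑ q, ∑ s, ‖α q i s t‖ * ‖x - y‖ :=
          norm_sum_le_of_le _ fun q _ => norm_sum_le_of_le _ fun s _ => by
            rw [norm_mul]
            exact mul_le_mul_of_nonneg_left (hxy q s) (norm_nonneg _)
      _ = (∑ q, ∑ s, ‖α q i s t‖) * ‖x - y‖ := by simp only [Finset.sum_mul]
      _ ≤ _ := by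
          refine mul_le_mul_of_nonneg_right ?_ (norm_nonneg _)
          have := Finset.single_le_sum (f := fun i => ∑ q, ∑ s, ‖α q i s t‖)
            (fun _ _ => Finset.sum_nonneg fun _ _ => Finset.sum_nonneg fun _ _ => norm_nonneg _)
            (Finset.mem_univ i)
          linarith

/-- `x` is a continuous solution on `[a,b]` of the integrated companion system with initial value
`c`. -/
def IsCompanionSolution (α : Fin r → Fin m → Fin m → ℝ → ℂ) (g : Fin m → ℝ → ℂ) (a b : ℝ)
    (c : Fin r → Fin m → ℂ) (x : ℝ → Fin r → Fin m → ℂ) : Prop :=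
  ContinuousOn x (Icc a b) ∧ ∀ t ∈ Icc a b, ∀ j i,
    x t j i = c j i + ∫ s in a..t, companion α g s (x s) j i

theorem companion_existsUnique (hab : a ≤ b)
    (hα : ∀ q i s, IntervalIntegrable (α q i s) volume a b)
    (hg : ∀ i, IntervalIntegrable (g i) volume a b) (c : Fin r → Fin m → ℂ) :
    ∃! x : C(Icc a b, Fin r → Fin m → ℂ), ∀ t : Icc a b,
      x t = c + ∫ s in a..(t : ℝ), companion α g s (IccExtend hab x s) := by
  refine caratheodory_existsUnique hab (companion α g)
    (fun t => 1 + ∑ i, ∑ q, ∑ s, ‖α q i s t‖) ?_ (fun t => ?_)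
    (fun x hx => intervalIntegrable_companion hab hα hg hx) norm_companion_sub_le c
  · refine intervalIntegrable_const.add ?_
    exact IntervalIntegrable.finset_sum' _ fun i _ => IntervalIntegrable.finset_sum' _ fun q _ =>
      IntervalIntegrable.finset_sum' _ fun s _ => (hα q i s).norm
  · positivity

theorem exists_isCompanionSolution (hab : a ≤ b)
    (hα : ∀ q i s, IntervalIntegrable (α q i s) volume a b)
    (hg : ∀ i, IntervalIntegrable (g i) volume a b) (c : Fin r → Fin m → ℂ) :
    ∃ x, IsCompanionSolution α g a b c x := by
  obtain ⟨x, hx, -⟩ := companion_existsUnique hab hα hg c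
  have hc : ContinuousOn (IccExtend hab x) (Icc a b) :=
    (x.continuous.Icc_extend' (h := hab)).continuousOn
  refine ⟨IccExtend hab x, hc, fun t ht j i => ?_⟩
  rw [IccExtend_of_mem hab x ht, hx ⟨t, ht⟩, Pi.add_apply, Pi.add_apply,
    integral_companion_apply hab hα hg hc ht]

/-- The contraction argument lives in `C(Icc a b, _)`, so both solutions are restricted to `[a,b]`;
the integrals see only values there. -/
theorem IsCompanionSolution.eqOn (hab : a ≤ b)
    (hα : ∀ q i s, IntervalIntegrable (α q i s) volume a b)
    (hg : ∀ i, IntervalIntegrable (g i) volume a b) {c : Fin r → Fin m → ℂ}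
    {x y : ℝ → Fin r → Fin m → ℂ} (hx : IsCompanionSolution α g a b c x)
    (hy : IsCompanionSolution α g a b c y) : EqOn x y (Icc a b) := by
  have key : ∀ {z}, IsCompanionSolution α g a b c z → ∃ w : C(Icc a b, Fin r → Fin m → ℂ),
      (∀ t : Icc a b, w t = z t) ∧ ∀ t : Icc a b,
        w t = c + ∫ s in a..(t : ℝ), companion α g s (IccExtend hab w s) := by
    intro z hz
    refine ⟨⟨(Icc a b).domRestrict z, hz.1.domRestrict⟩, fun t => rfl, fun t => ?_⟩
    funext j i
    have hs : uIcc a (t : ℝ) ⊆ Icc a b := by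
      rw [uIcc_of_le t.2.1]
      exact Icc_subset_Icc_right t.2.2
    have he : ∫ s in a..(t : ℝ), companion α g s (IccExtend hab ((Icc a b).domRestrict z) s) =
        ∫ s in a..(t : ℝ), companion α g s (z s) :=
      intervalIntegral.integral_congr fun s h => by
        simp only [IccExtend_of_mem hab _ (hs h), domRestrict_apply]
    simp only [ContinuousMap.coe_mk]
    rw [he, Pi.add_apply, Pi.add_apply, integral_companion_apply hab hα hg hz.1 t.2]
    exact hz.2 t t.2 j i
  obtain ⟨u, hu, hu'⟩ := key hx
  obtain ⟨w, hw, hw'⟩ := key hy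
  obtain rfl : u = w := (companion_existsUnique hab hα hg c).unique hu' hw'
  exact fun t ht => (hu ⟨t, ht⟩).symm.trans (hw ⟨t, ht⟩)

/-- Solutions of the companion system inherit the Sobolev regularity of the data. -/
theorem IsCompanionSolution.memSobolev {p : ℝ≥0∞} {n : ℕ} (hab : a < b) (hp : 1 ≤ p)
    (hα : ∀ q i s, MemSobolev a b p n (α q i s)) (hg : ∀ i, MemSobolev a b p n (g i))
    {c : Fin r → Fin m → ℂ} {x : ℝ → Fin r → Fin m → ℂ} (hx : IsCompanionSolution α g a b c x)
    (i : Fin m) :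
    MemSobolev a b p n (fun t => g i t - ∑ q, ∑ s, α q i s t * x t q s) := by
  have hc : ∀ q s, ContinuousOn (fun t => x t q s) (Icc a b) := fun q s =>
    continuousOn_pi.1 (continuousOn_pi.1 hx.1 q) s
  have of_mul : ∀ k ≤ n, (∀ q i s, MemSobolev a b p k (α q i s * fun t => x t q s)) →
      ∀ i, MemSobolev a b p k (fun t => g i t - ∑ q, ∑ s, α q i s t * x t q s) := by
    intro k hk h i
    have := ((hg i).of_le hab hk).add hab ((MemSobolev.sum Finset.univ hab fun q _ =>
      MemSobolev.sum Finset.univ hab fun s _ => h q i s).const_smul (-1))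
    refine this.congr hab fun t _ => ?_
    simp [sub_eq_add_neg]
  have of_rhs : ∀ k, (∀ j i, MemSobolev a b p k (fun t => x t j i)) →
      (∀ i, MemSobolev a b p k (fun t => g i t - ∑ q, ∑ s, α q i s t * x t q s)) →
      ∀ j i, MemSobolev a b p (k + 1) (fun t => x t j i) := by
    intro k h1 h2 j i
    have h3 : MemSobolev a b p k (fun t => companion α g t (x t) j i) := by
      unfold companion
      split_ifs with h
      · exact h1 _ _
      · exact h2 i
    exact (h3.integral hab hp (c j i)).congr hab fun t ht => (hx.2 t ht j i).symm
  -- Bootstrap: integrating the system raises the order of `x` by one, and products with the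
  -- coefficients keep that order up to `n`. At order `0` the algebra property fails, and continuity
  -- of `x` replaces it.
  have main : ∀ k ≤ n, (∀ j i, MemSobolev a b p k (fun t => x t j i)) ∧
      ∀ i, MemSobolev a b p k (fun t => g i t - ∑ q, ∑ s, α q i s t * x t q s) := by
    intro k
    induction k with
    | zero =>
      refine fun hk => ⟨fun j i => MemSobolev.memLp_of_continuousOn (hc j i),
        of_mul 0 hk fun q i s => ?_⟩
      exact MemSobolev.memLp_mul ((hα q i s).of_le (k := 0) hab hk) (hc q s)
    | succ k ih =>
      intro hk
      obtain ⟨h1, h2⟩ := ih (by omega)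
      have h3 := of_rhs k h1 h2
      exact ⟨h3, of_mul _ hk fun q i s => ((hα q i s).of_le hab hk).mul_succ hab hp (h3 q s)⟩
  exact (main n le_rfl).2 i

end Companion

/-! ### The Cauchy problem for `L` -/

namespace Sobolev

variable {a b : ℝ} [hab : Fact (a < b)] {p : ℝ≥0∞} [hp : Fact (1 ≤ p)] {k : ℕ}

theorem deriv_mk_ae_eq (y : ℝ → ℂ) (hy : MemSobolev a b p k y) {i : ℕ} (hi : i ≤ k) :
    (mk y hy).deriv i =ᵐ[volume.restrict (Icc a b)] iteratedDerivWithin i y (Icc a b) :=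
  ((mk y hy).coe_ae_eq_deriv ⟨i, Nat.lt_succ_iff.2 hi⟩).symm.trans
    (MemLp.coeFn_toLp (hy.memLp_iteratedDerivWithin hab.out hi))

theorem deriv_eqOn_of_ae_eq (u : Sobolev a b p k) {i : ℕ} (hi : i < k) {f : ℝ → ℂ}
    (hf : ContinuousOn f (Icc a b)) (h : u.deriv i =ᵐ[volume.restrict (Icc a b)] f) :
    EqOn (u.deriv i) f (Icc a b) :=
  Measure.eqOn_Icc_of_ae_eq _ hab.out.ne h (u.continuousOn_deriv hi) hf

end Sobolev

namespace BVP

variable {a b : ℝ} [hab : Fact (a < b)] {p : ℝ≥0∞} [hp : Fact (1 ≤ p)] {m n r l : ℕ}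

/-- The integrated system needs the equation only almost everywhere, as `L A y = f` supplies it. -/
theorem isCompanionSolution_deriv (A : Fin r → Matrix (Fin m) (Fin m) (Sobolev a b p n))
    {y : Fin m → Sobolev a b p (n + r)} {f : Fin m → Sobolev a b p n} (hy : L A y = f) :
    IsCompanionSolution (fun q i s => (A q i s).rep) (fun i => (f i).rep) a b
      (fun j i => (y i).deriv j a) (fun t j i => (y i).deriv j t) := by
  refine ⟨continuousOn_pi.2 fun j => continuousOn_pi.2 fun i =>
    (y i).continuousOn_deriv (by omega), fun t ht j i => ?_⟩
  refine ((y i).deriv_eq_add_integral (by omega) ht).trans ?_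
  congr 1
  unfold companion
  split_ifs with h
  · rfl
  · refine ae_eq_integral_congr ?_ ht
    have hj : (j : ℕ) + 1 = r := by omega
    filter_upwards [(L_eq_iff A y f).1 hy i] with s hs
    rw [← hs, hj]
    simp [diffExpr]

theorem L_deriv_injective (A : Fin r → Matrix (Fin m) (Fin m) (Sobolev a b p n)) (hr : 1 ≤ r)
    {y z : Fin m → Sobolev a b p (n + r)} (h : L A y = L A z)
    (h0 : ∀ (j : Fin r) i, (y i).deriv j a = (z i).deriv j a) : y = z := by
  have hy := isCompanionSolution_deriv A h
  have hz := isCompanionSolution_deriv A (rfl : L A z = L A z)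
  simp only [h0] at hy
  have := hy.eqOn hab.out.le (fun q i s => (A q i s).memSobolev_rep.intervalIntegrable hab.out hp.out)
    (fun i => (L A z i).memSobolev_rep.intervalIntegrable hab.out hp.out) hz
  funext i
  refine Sobolev.ext_ae ((y i).coe_zero_ae_eq_rep.trans
    (EventuallyEq.trans ?_ (z i).coe_zero_ae_eq_rep.symm))
  refine MemSobolev.ae_of_eqOn fun t ht => ?_
  -- Component `0` of the companion vector is the function itself; it exists because `1 ≤ r`.
  simpa [Sobolev.deriv] using congrFun (congrFun (this ht) ⟨0, hr⟩) i

theorem exists_L_eq_deriv_eq (A : Fin r → Matrix (Fin m) (Fin m) (Sobolev a b p n))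
    (f : Fin m → Sobolev a b p n) (c : Fin r → Fin m → ℂ) :
    ∃ y : Fin m → Sobolev a b p (n + r), L A y = f ∧
      ∀ (j : Fin r) i, (y i).deriv j a = c j i := by
  obtain ⟨x, hx⟩ := exists_isCompanionSolution (α := fun q i s => (A q i s).rep)
    (g := fun i => (f i).rep) hab.out.le
    (fun q i s => (A q i s).memSobolev_rep.intervalIntegrable hab.out hp.out)
    (fun i => (f i).memSobolev_rep.intervalIntegrable hab.out hp.out) c
  have hrhs := hx.memSobolev hab.out hp.out (fun q i s => (A q i s).memSobolev_rep)
    (fun i => (f i).memSobolev_rep)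
  let w : Fin m → ℝ → ℂ := fun i t =>
    (f i).rep t - ∑ q, ∑ s, (A q i s).rep t * x t q s
  -- The chain consists of the companion components followed by `w`, the prescribed `r`-th
  -- derivative. As `w` lies in `W_p^n`, the chain comes from a function in `W_p^{n+r}`.
  let v : Fin m → ℕ → ℝ → ℂ := fun i j => if h : j < r then fun t => x t ⟨j, h⟩ i else w i
  have hvr : ∀ i, v i r = w i := fun i => dif_neg (lt_irrefl r)
  have hvj : ∀ i j (h : j < r), v i j = fun t => x t ⟨j, h⟩ i := fun i j h => dif_pos h
  have hchain : ∀ i, ∃ y, MemSobolev a b p (n + r) y ∧ ∀ j ≤ r,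
      iteratedDerivWithin j y (Icc a b) =ᵐ[volume.restrict (Icc a b)] v i j := by
    intro i
    refine MemSobolev.exists_of_chain hab.out hp.out (v i)
      (fun j => if h : j < r then c ⟨j, h⟩ i else 0) (by rw [hvr]; exact hrhs i) fun j hj => ?_
    refine MemSobolev.ae_of_eqOn fun t ht => ?_
    rw [hvj i j hj]
    simp only [hj, dif_pos]
    rw [hx.2 t ht ⟨j, hj⟩ i]
    congr 2
    funext s
    by_cases h : j + 1 < r
    · simp [companion, h, hvj i (j + 1) h]
    · obtain rfl : j + 1 = r := by omega
      rw [hvr]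
      simp [companion, w]
  choose y hy hyv using hchain
  have hd : ∀ i j, j ≤ r → (Sobolev.mk (y i) (hy i)).deriv j
      =ᵐ[volume.restrict (Icc a b)] v i j := fun i j hj =>
    (Sobolev.deriv_mk_ae_eq _ _ (by omega)).trans (hyv i j hj)
  -- Both sides are continuous for `j < r`, so equality almost everywhere holds everywhere, in
  -- particular at `a`.
  have hdx : ∀ i (j : Fin r), EqOn ((Sobolev.mk (y i) (hy i)).deriv j) (fun t => x t j i)
      (Icc a b) := fun i j =>
    Sobolev.deriv_eqOn_of_ae_eq _ (by omega)
      (continuousOn_pi.1 (continuousOn_pi.1 hx.1 j) i) (by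
        have := hd i j j.2.le
        rwa [hvj i j j.2] at this)
  refine ⟨fun i => Sobolev.mk (y i) (hy i), (L_eq_iff _ _ _).2 fun i => ?_, fun j i => ?_⟩
  · have h1 := hd i r le_rfl
    rw [hvr] at h1
    filter_upwards [h1, ae_restrict_mem measurableSet_Icc] with t ht htI
    simp only [diffExpr, ht, w]
    rw [sub_add_eq_add_sub, add_sub_assoc, add_eq_left, sub_eq_zero]
    exact Finset.sum_congr rfl fun j _ => Finset.sum_congr rfl fun s _ => by rw [hdx s j htI]
  · have ha : a ∈ Icc a b := left_mem_Icc.2 hab.out.le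
    rw [hdx i j ha]
    simpa using hx.2 a ha j i

/-- The initial values `y^(j)(a)`, `j < r`. -/
noncomputable def initialValues (r : ℕ) :
    (Fin m → Sobolev a b p (n + r)) →ₗ[ℂ] (Fin r → Fin m → ℂ) where
  toFun y j i := (y i).deriv j a
  map_add' y z := by
    funext j i
    have hj : (j : ℕ) < n + r := by omega
    exact Sobolev.deriv_eqOn_of_ae_eq _ hj
      (((y i).continuousOn_deriv hj).add ((z i).continuousOn_deriv hj))
      (Sobolev.deriv_add_ae (y i) (z i) hj.le) (left_mem_Icc.2 hab.out.le)
  map_smul' c y := by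
    funext j i
    have hj : (j : ℕ) < n + r := by omega
    exact Sobolev.deriv_eqOn_of_ae_eq _ hj (((y i).continuousOn_deriv hj).const_smul c)
      (Sobolev.deriv_smul_ae c (y i) hj.le) (left_mem_Icc.2 hab.out.le)

end BVP

/-! ### The characteristic matrix and invertibility -/

namespace BVP

variable {a b : ℝ} [hab : Fact (a < b)] {p : ℝ≥0∞} [hp : Fact (1 ≤ p)] {m n r l : ℕ}

theorem isInvertible_iff_bijective {X Y : Type*} [NormedAddCommGroup X] [NormedSpace ℂ X]
    [CompleteSpace X] [NormedAddCommGroup Y] [NormedSpace ℂ Y] [CompleteSpace Y] {T : X →ₗ[ℂ] Y}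
    (hT : Continuous T) : IsInvertible T ↔ Function.Bijective T := by
  constructor
  · rintro ⟨e, he⟩
    have : ⇑T = e := funext fun x => (he x).symm
    rw [this]
    exact e.bijective
  · intro h
    exact ⟨ContinuousLinearEquiv.ofBijective ⟨T, hT⟩ (LinearMap.ker_eq_bot.2 h.1)
      (LinearMap.range_eq_top.2 h.2), fun x => rfl⟩

theorem isInvertible_operator_iff_bijective (A : Fin r → Matrix (Fin m) (Fin m) (Sobolev a b p n))
    (B : (Fin m → Sobolev a b p (n + r)) →L[ℂ] (Fin l → ℂ)) :
    IsInvertible (operator A B) ↔ Function.Bijective (operator A B) :=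
  isInvertible_iff_bijective (X := Fin m → Sobolev a b p (n + r))
    (Y := (Fin m → Sobolev a b p n) × (Fin l → ℂ)) (T := operator A B)
    ((continuous_L A).prodMk B.continuous)

/-- Read column by column, the matrix problems prescribe the standard basis of `ℂ^{mr}` as initial
data. -/
theorem isCauchySystem_iff {A : Fin r → Matrix (Fin m) (Fin m) (Sobolev a b p n)}
    {Y : Fin r → Matrix (Fin m) (Fin m) (Sobolev a b p (n + r))} :
    IsCauchySystem A Y ↔ ∀ k c, L A (fun i => Y k i c) = 0 ∧
      initialValues r (fun i => Y k i c) = Pi.single k (Pi.single c 1) := by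
  have h : ∀ k c, initialValues r (fun i => Y k i c) = Pi.single k (Pi.single c 1) ↔
      ∀ q : Fin r, ∀ i, (Y k i c).deriv q a =
        (if k = q then (1 : Matrix (Fin m) (Fin m) ℂ) else 0) i c := by
    intro k c
    rw [funext_iff]
    refine forall_congr' fun q => ?_
    rw [funext_iff]
    refine forall_congr' fun i => ?_
    have : (Pi.single k (Pi.single c 1) : Fin r → Fin m → ℂ) q i =
        (if k = q then (1 : Matrix (Fin m) (Fin m) ℂ) else 0) i c := by
      by_cases hk : k = q
      · subst hk
        simp [Matrix.one_apply, Pi.single_apply]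
      · simp [hk, Ne.symm hk]
    rw [← this]
    rfl
  simp only [h]
  constructor
  · intro H k c
    exact ⟨(H k).1 c, fun q i => congrFun (congrFun ((H k).2 q) i) c⟩
  · intro H k
    refine ⟨fun c => (H k c).1, fun q => ?_⟩
    ext i c
    exact (H k c).2 q i

theorem existsUnique_isCauchySystem (A : Fin r → Matrix (Fin m) (Fin m) (Sobolev a b p n))
    (hr : 1 ≤ r) :
    ∃! Y : Fin r → Matrix (Fin m) (Fin m) (Sobolev a b p (n + r)), IsCauchySystem A Y := by
  choose y hy hy0 using fun (k : Fin r) (c : Fin m) =>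
    exists_L_eq_deriv_eq A 0 (Pi.single k (Pi.single c 1))
  have hsys : IsCauchySystem A fun k => Matrix.of fun i c => y k c i :=
    isCauchySystem_iff.2 fun k c => ⟨hy k c, funext fun j => funext fun i => hy0 k c j i⟩
  refine ⟨_, hsys, fun Z hZ => ?_⟩
  funext k
  ext i c : 1
  have hZ' := isCauchySystem_iff.1 hZ k c
  refine congrFun (L_deriv_injective A hr (y := fun i => Z k i c) (z := y k c)
    (hZ'.1.trans (hy k c).symm) fun j i => ?_) i
  rw [hy0]
  exact congrFun (congrFun hZ'.2 j) i

/-- The block of `ℂ^{mr}` that the column index of `charMatrix` refers to. -/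
def blockEquiv (m r : ℕ) : Fin (m * r) ≃ Fin r × Fin m :=
  (finCongr (Nat.mul_comm m r)).trans finProdFinEquiv.symm

/-- By linearity of `B`; for a Cauchy system this identifies the matrix with `B` on `ker L` in
fundamental coordinates. -/
theorem charMatrix_mulVec (B : (Fin m → Sobolev a b p (n + r)) →L[ℂ] (Fin l → ℂ))
    (Y : Fin r → Matrix (Fin m) (Fin m) (Sobolev a b p (n + r))) (v : Fin (m * r) → ℂ) :
    (charMatrix B Y).mulVec v =
      B (∑ q, v q • fun s => Y (blockEquiv m r q).1 s (blockEquiv m r q).2) := by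
  rw [map_sum]
  funext i
  rw [Finset.sum_apply, Matrix.mulVec, dotProduct]
  refine Finset.sum_congr rfl fun q _ => ?_
  rw [map_smul, Pi.smul_apply, smul_eq_mul, mul_comm]
  rfl

theorem IsCauchySystem.L_sum {A : Fin r → Matrix (Fin m) (Fin m) (Sobolev a b p n)}
    {Y : Fin r → Matrix (Fin m) (Fin m) (Sobolev a b p (n + r))} (hY : IsCauchySystem A Y)
    (v : Fin (m * r) → ℂ) :
    L A (∑ q, v q • fun s => Y (blockEquiv m r q).1 s (blockEquiv m r q).2) = 0 := by
  refine (map_sum (L A) _ _).trans (Finset.sum_eq_zero fun q _ => ?_)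
  rw [map_smul, (isCauchySystem_iff.1 hY _ _).1, smul_zero]

theorem IsCauchySystem.initialValues_sum {A : Fin r → Matrix (Fin m) (Fin m) (Sobolev a b p n)}
    {Y : Fin r → Matrix (Fin m) (Fin m) (Sobolev a b p (n + r))} (hY : IsCauchySystem A Y)
    (v : Fin (m * r) → ℂ) (q : Fin (m * r)) :
    initialValues r (∑ q, v q • fun s => Y (blockEquiv m r q).1 s (blockEquiv m r q).2)
      (blockEquiv m r q).1 (blockEquiv m r q).2 = v q := by
  rw [map_sum, Finset.sum_apply, Finset.sum_apply, Finset.sum_eq_single q]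
  · rw [map_smul, (isCauchySystem_iff.1 hY _ _).2]
    simp
  · intro q' _ hq
    rw [map_smul, (isCauchySystem_iff.1 hY _ _).2]
    have hne : blockEquiv m r q' ≠ blockEquiv m r q := fun h => hq ((blockEquiv m r).injective h)
    by_cases h1 : (blockEquiv m r q').1 = (blockEquiv m r q).1
    · have h2 : (blockEquiv m r q').2 ≠ (blockEquiv m r q).2 := fun h => hne (Prod.ext h1 h)
      simp [h1, Ne.symm h2]
    · simp [Ne.symm h1]
  · simp

/-- Every solution of the homogeneous equation is the combination of the fundamental solutions with
its initial values as coefficients. -/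
theorem IsCauchySystem.eq_sum {A : Fin r → Matrix (Fin m) (Fin m) (Sobolev a b p n)}
    {Y : Fin r → Matrix (Fin m) (Fin m) (Sobolev a b p (n + r))} (hY : IsCauchySystem A Y)
    (hr : 1 ≤ r) {y : Fin m → Sobolev a b p (n + r)} (hy : L A y = 0) :
    y = ∑ q, initialValues r y (blockEquiv m r q).1 (blockEquiv m r q).2 •
      fun s => Y (blockEquiv m r q).1 s (blockEquiv m r q).2 := by
  refine L_deriv_injective A hr (hy.trans (hY.L_sum _).symm) fun j i => ?_
  have := hY.initialValues_sum
    (fun q => initialValues r y (blockEquiv m r q).1 (blockEquiv m r q).2)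
    ((blockEquiv m r).symm (j, i))
  simp only [Equiv.apply_symm_apply] at this
  exact this.symm

theorem IsCauchySystem.bijective_operator_iff
    {A : Fin r → Matrix (Fin m) (Fin m) (Sobolev a b p n)}
    {Y : Fin r → Matrix (Fin m) (Fin m) (Sobolev a b p (n + r))} (hY : IsCauchySystem A Y)
    (hr : 1 ≤ r) (B : (Fin m → Sobolev a b p (n + r)) →L[ℂ] (Fin l → ℂ)) :
    Function.Bijective (operator A B) ↔ Function.Bijective (charMatrix B Y).mulVec := by
  have hop : ∀ y, operator A B y = (L A y, B y) := fun _ => rfl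
  constructor
  · rintro ⟨hi, hs⟩
    constructor
    · intro v w hvw
      rw [charMatrix_mulVec, charMatrix_mulVec] at hvw
      have := hi (a₁ := ∑ q, v q • fun s => Y (blockEquiv m r q).1 s (blockEquiv m r q).2)
        (a₂ := ∑ q, w q • fun s => Y (blockEquiv m r q).1 s (blockEquiv m r q).2)
        (by rw [hop, hop, hvw, hY.L_sum, hY.L_sum])
      funext q
      rw [← hY.initialValues_sum v q, ← hY.initialValues_sum w q, this]
    · intro d
      obtain ⟨y, hy⟩ := hs (0, d)
      rw [hop, Prod.mk.injEq] at hy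
      refine ⟨fun q => initialValues r y (blockEquiv m r q).1 (blockEquiv m r q).2, ?_⟩
      rw [charMatrix_mulVec, ← hY.eq_sum hr hy.1, hy.2]
  · rintro ⟨hi, hs⟩
    constructor
    · rw [← LinearMap.ker_eq_bot, LinearMap.ker_eq_bot']
      intro y hy
      rw [hop, Prod.mk_eq_zero] at hy
      have he := hY.eq_sum hr hy.1
      have h0 := hi (a₁ := fun q => initialValues r y (blockEquiv m r q).1 (blockEquiv m r q).2)
        (a₂ := 0) (by rw [charMatrix_mulVec, ← he, hy.2, Matrix.mulVec_zero])
      rw [he]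
      exact Finset.sum_eq_zero fun q _ => by rw [congrFun h0 q, Pi.zero_apply, zero_smul]
    · rintro ⟨f, d⟩
      -- Any solution of `Ly = f` will do; an element of `ker L` then corrects the defect `d - By`
      -- without changing `Ly`.
      obtain ⟨y, hy, -⟩ := exists_L_eq_deriv_eq A f 0
      obtain ⟨v, hv⟩ := hs (d - B y)
      rw [charMatrix_mulVec] at hv
      refine ⟨y + ∑ q, v q • fun s => Y (blockEquiv m r q).1 s (blockEquiv m r q).2, ?_⟩
      rw [hop, map_add, map_add, hY.L_sum, hv, hy, add_zero, add_sub_cancel]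

end BVP

theorem Matrix.bijective_mulVec_iff_det_ne_zero {K : Type*} [Field K] {l k : ℕ}
    (M : Matrix (Fin l) (Fin k) K) :
    Function.Bijective M.mulVec ↔ ∃ h : l = k, (M.submatrix id (Fin.cast h)).det ≠ 0 := by
  have sq : ∀ {j : ℕ} (N : Matrix (Fin j) (Fin j) K),
      Function.Bijective N.mulVec ↔ N.det ≠ 0 := by
    intro j N
    rw [← isUnit_iff_ne_zero, ← Matrix.isUnit_iff_isUnit_det, ← Matrix.mulVec_injective_iff_isUnit]
    refine ⟨fun h => h.1, fun h => ⟨h, ?_⟩⟩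
    rwa [Matrix.mulVec_surjective_iff_isUnit, ← Matrix.mulVec_injective_iff_isUnit]
  constructor
  · intro h
    have hlk : l = k := by
      -- Bijectivity forces equal dimensions, so a determinant makes sense.
      have := (LinearEquiv.ofBijective M.mulVecLin h).finrank_eq
      simpa using this.symm
    subst hlk
    exact ⟨rfl, (sq M).1 h⟩
  · rintro ⟨rfl, h⟩
    exact (sq M).2 h

end

theorem corollary1 (a b : ℝ) [Fact (a < b)] (p : ℝ≥0∞) [Fact (1 ≤ p)]
    (m n r l : ℕ) (hm : 1 ≤ m) (hr : 1 ≤ r) (hl : 1 ≤ l)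
    (A : Fin r → Matrix (Fin m) (Fin m) (Sobolev a b p n))
    (B : (Fin m → Sobolev a b p (n + r)) →L[ℂ] (Fin l → ℂ)) :
    (∃! Y : Fin r → Matrix (Fin m) (Fin m) (Sobolev a b p (n + r)), BVP.IsCauchySystem A Y) ∧
    ∀ Y : Fin r → Matrix (Fin m) (Fin m) (Sobolev a b p (n + r)), BVP.IsCauchySystem A Y →
      (BVP.IsInvertible (BVP.operator A B) ↔
        ∃ h : l = m * r, ((BVP.charMatrix B Y).submatrix id (Fin.cast h)).det ≠ 0) := by
  refine ⟨BVP.existsUnique_isCauchySystem A hr, fun Y hY => ?_⟩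
  rw [BVP.isInvertible_operator_iff_bijective, hY.bijective_operator_iff hr,
    Matrix.bijective_mulVec_iff_det_ne_zero]
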